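/- Let $N\ge 1$ and let $0\le\mu\in L^1(\mathbb R^N)$ be the density of a probability measure $d\mu=\mu\,dx$ such that $\mu\in H^1_{\rm loc}(\mathbb R^N)$, $\frac{\nabla\mu}{\mu}\in L^r_{\rm loc}(\mathbb R^N,\mathbb R^N)$ for some $r>N$, and $\inf_K\mu>0$ for every compact $K\subset\mathbb R^N$. Write $L^2_\mu(\mathbb R^N)=L^2(\mathbb R^N,d\mu)$ (complex-valued functions). Let $(L,D(L))$ be the closure in $L^2_\mu(\mathbb R^N)$ of the operator $L\varphi=\Delta\varphi+\frac{\nabla\mu}{\mu}\cdot\nabla\varphi$, $\varphi\in C_c^\infty(\mathbb R^N)$, and let $(A,D(A))$ be the operator in $L^2_\mu(\mathbb R^N)$ associated to the sesquilinear form $$a_L(u,v)=\int_{\mathbb R^N}Lu\,\overline{Lv}\,d\mu,\qquad u,v\in D(a_L)=D(L),$$ that is, $u\in D(A)$ and $Au=w$ if and only if $u\in D(L)$, $w\in L^2_\mu(\mathbb R^N)$ and $a_L(u,v)=\int_{\mathbb R^N}w\,\overline v\,d\mu$ for all $v\in D(L)$. Assume that there exists $n\in\mathbb N$ such that $D(A^n)\subset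 L^\infty_{\rm loc}(\mathbb R^N)$, and that $0$ is a simple pole of $\sigma(-A)$, i.e. $0$ is an isolated point of $\sigma(-A)$ and a pole of order one of the resolvent $\lambda\mapsto(\lambda+A)^{-1}$. Then $-A$ generates a $C_0$-semigroup $(e^{-tA})_{t\ge0}$ on $L^2_\mu(\mathbb R^N)$ which is locally uniformly eventually positive: for every compact set $K\subset\mathbb R^N$ there exists $t_0>0$ such that for every $f\in L^2_\mu(\mathbb R^N)$ which satisfies $f\ge0$ a.e. on $K$ and $f>0$ on a subset of $K$ of positive Lebesgue measure there exists $c>0$ with $$e^{-tA}(\chi_Kf)(x)\ge c\qquad\text{for all } t\ge t_0\text{ and a.e. }x\in K .$$ -/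

import Mathlib

open MeasureTheory Filter Topology
open scoped ENNReal ContDiff ComplexOrder InnerProductSpace Laplacian

noncomputable section

/-! ### Unbounded operators: powers, resolvent, semigroups, operators associated to forms -/

section Abstract

variable {E : Type*} [NormedAddCommGroup E] [NormedSpace ℂ E]

/-- `x ∈ D(Gⁿ)`: `D(G⁰)` is the whole space, `D(Gⁿ⁺¹)` consists of the `x ∈ D(G)` with
`G x ∈ D(Gⁿ)`. -/
def MemPowDomain (G : E →ₗ.[ℂ] E) : ℕ → E → Prop
  | 0, _ => True
  | n + 1, x => ∃ hx : x ∈ G.domain, MemPowDomain G n (G ⟨x, hx⟩)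

/-- The bounded operator `R` is the two-sided inverse of `z - G : D(G) → E`. -/
def IsResolventAt (G : E →ₗ.[ℂ] E) (z : ℂ) (R : E →L[ℂ] E) : Prop :=
  (∀ x : E, ∃ hx : R x ∈ G.domain, z • R x - G ⟨R x, hx⟩ = x) ∧
    ∀ x : G.domain, R (z • (x : E) - G x) = x

/-- The resolvent set `ρ(G)`. -/
def operatorResolventSet (G : E →ₗ.[ℂ] E) : Set ℂ := {z | ∃ R, IsResolventAt G z R}

/-- The spectrum `σ(G)`. -/
def operatorSpectrum (G : E →ₗ.[ℂ] E) : Set ℂ := (operatorResolventSet G)ᶜ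

open scoped Classical in
/-- The resolvent `z ↦ R(z, G) = (z - G)⁻¹`, with the value `0` outside `ρ(G)`. -/
def operatorResolvent (G : E →ₗ.[ℂ] E) (z : ℂ) : E →L[ℂ] E :=
  if h : ∃ R, IsResolventAt G z R then h.choose else 0

/-- `z₀` is an isolated point of `σ(G)` at which the resolvent has a pole of order one. -/
def IsSimplePoleOfSpectrum (G : E →ₗ.[ℂ] E) (z₀ : ℂ) : Prop :=
  z₀ ∈ operatorSpectrum G ∧
    (∀ᶠ z in 𝓝[≠] z₀, z ∈ operatorResolventSet G) ∧
    MeromorphicAt (operatorResolvent G) z₀ ∧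
    meromorphicOrderAt (operatorResolvent G) z₀ = (-1 : ℤ)

/-- `(T t)_{t ≥ 0}` is the `C₀`-semigroup of bounded operators whose generator is `G`;
the values `T t` with `t < 0` play no role. -/
structure IsC0SemigroupGeneratedBy (T : ℝ → E →L[ℂ] E) (G : E →ₗ.[ℂ] E) : Prop where
  zero : T 0 = ContinuousLinearMap.id ℂ E
  add : ∀ s t : ℝ, 0 ≤ s → 0 ≤ t → T (s + t) = (T s).comp (T t)
  continuous : ∀ x : E, Tendsto (fun t : ℝ => T t x) (𝓝[>] 0) (𝓝 x)
  generator : ∀ x y : E, (x, y) ∈ G.graph ↔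
    Tendsto (fun t : ℝ => (t : ℂ)⁻¹ • (T t x - x)) (𝓝[>] 0) (𝓝 y)

end Abstract

section Form

variable {H : Type*} [NormedAddCommGroup H] [InnerProductSpace ℂ H]

/-- The sesquilinear form `a_L(u, v) = ⟨L u, L v⟩` on `D(a_L) = D(L)`, linear in `u` and antilinear
in `v` (Mathlib's inner product is antilinear in its first argument). -/
def squareForm (L : H →ₗ.[ℂ] H) (u v : L.domain) : ℂ := inner ℂ (L v) (L u)

/-- The pairs `(u, w)` with `u ∈ D(a_L)` and `a_L(u, v) = ⟨w, v⟩` for all `v ∈ D(a_L)`. -/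
def squareFormGraph (L : H →ₗ.[ℂ] H) : Submodule ℂ (H × H) where
  carrier := {p | ∃ hu : p.1 ∈ L.domain,
    ∀ v : L.domain, squareForm L ⟨p.1, hu⟩ v = inner ℂ (v : H) p.2}
  add_mem' := by
    rintro ⟨u, w⟩ ⟨u', w'⟩ ⟨hu, h⟩ ⟨hu', h'⟩
    refine ⟨L.domain.add_mem hu hu', fun v => ?_⟩
    have e : (⟨u + u', L.domain.add_mem hu hu'⟩ : L.domain) = ⟨u, hu⟩ + ⟨u', hu'⟩ := rfl
    have h1 := h v
    have h2 := h' v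
    simp only [squareForm] at h1 h2
    simp only [squareForm, Prod.mk_add_mk, e, LinearPMap.map_add, inner_add_right, h1, h2]
  zero_mem' := by
    refine ⟨L.domain.zero_mem, fun v => ?_⟩
    have e : (⟨(0 : H), L.domain.zero_mem⟩ : L.domain) = 0 := rfl
    simp [squareForm, e]
  smul_mem' := by
    rintro c ⟨u, w⟩ ⟨hu, h⟩
    refine ⟨L.domain.smul_mem c hu, fun v => ?_⟩
    have e : (⟨c • u, L.domain.smul_mem c hu⟩ : L.domain) = c • ⟨u, hu⟩ := rfl
    have h1 := h v
    simp only [squareForm] at h1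
    simp only [squareForm, Prod.smul_mk, e, LinearPMap.map_smul, inner_smul_right, h1]

/-- The operator associated to the form `a_L`: `u ∈ D(A)` and `A u = w` iff `u ∈ D(L)` and
`a_L(u, v) = ⟨w, v⟩` for all `v ∈ D(L)`. -/
def squareFormOperator (L : H →ₗ.[ℂ] H) : H →ₗ.[ℂ] H := (squareFormGraph L).toLinearPMap

/-- If `L` is densely defined, the graph of the associated operator is the one just described. -/
theorem squareFormOperator_graph (L : H →ₗ.[ℂ] H) (hL : Dense (L.domain : Set H)) :
    (squareFormOperator L).graph = squareFormGraph L := by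
  refine Submodule.toLinearPMap_graph_eq _ ?_
  rintro ⟨u, w⟩ ⟨hu, h⟩ rfl
  have e : (⟨(0 : H), hu⟩ : L.domain) = 0 := rfl
  refine hL.eq_zero_of_inner_right (𝕜 := ℂ) fun v hv => ?_
  have h1 := h ⟨v, hv⟩
  simp only [squareForm, e, LinearPMap.map_zero, inner_zero_right] at h1
  exact h1.symm

end Form

/-! ### The Kolmogorov and bi-Kolmogorov operators -/

section Kolmogorov

variable {N : ℕ}

/-- `φ ∈ C_c^∞(ℝᴺ)` with values in `F`. -/
def IsTestFunction {F : Type*} [NormedAddCommGroup F] [NormedSpace ℝ F]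
    (φ : EuclideanSpace ℝ (Fin N) → F) : Prop :=
  ContDiff ℝ ∞ φ ∧ HasCompactSupport φ

/-- `f ∈ L^p_loc(ℝᴺ)` with respect to Lebesgue measure. -/
def MemLpLoc {F : Type*} [NormedAddCommGroup F] (f : EuclideanSpace ℝ (Fin N) → F)
    (p : ℝ≥0∞) : Prop :=
  ∀ K : Set (EuclideanSpace ℝ (Fin N)), IsCompact K → MemLp f p (volume.restrict K)

/-- `g` is the weak (distributional) gradient of `m`. -/
def IsWeakGradient (m : EuclideanSpace ℝ (Fin N) → ℝ)
    (g : EuclideanSpace ℝ (Fin N) → EuclideanSpace ℝ (Fin N)) : Prop :=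
  ∀ φ : EuclideanSpace ℝ (Fin N) → ℝ, IsTestFunction φ → ∀ i : Fin N,
    ∫ x, m x * fderiv ℝ φ x (EuclideanSpace.single i 1) = -∫ x, g x i * φ x

/-- `m` is the density of a probability measure on `ℝᴺ`. -/
structure IsProbabilityDensity (m : EuclideanSpace ℝ (Fin N) → ℝ) : Prop where
  nonneg : ∀ᵐ x, 0 ≤ m x
  integrable : Integrable m
  integral_eq_one : ∫ x, m x = 1

/-- The standing hypothesis on the density `m` with weak gradient `g = ∇m`: `m ∈ H¹_loc`,
`∇m / m ∈ L^r_loc` for some `r > N`, and `m` is bounded below by a positive constant on every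
compact set. -/
structure HypothesisH1 (m : EuclideanSpace ℝ (Fin N) → ℝ)
    (g : EuclideanSpace ℝ (Fin N) → EuclideanSpace ℝ (Fin N)) : Prop where
  memLpLoc : MemLpLoc m 2
  memLpLoc_grad : MemLpLoc g 2
  isWeakGradient : IsWeakGradient m g
  drift : ∃ r : ℝ, (N : ℝ) < r ∧ MemLpLoc (fun x => (m x)⁻¹ • g x) (ENNReal.ofReal r)
  lower_bound : ∀ K : Set (EuclideanSpace ℝ (Fin N)), IsCompact K →
    ∃ c : ℝ, 0 < c ∧ ∀ᵐ x ∂volume.restrict K, c ≤ m x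

/-- The measure `dμ = m dx`. -/
def densityMeasure (m : EuclideanSpace ℝ (Fin N) → ℝ) : Measure (EuclideanSpace ℝ (Fin N)) :=
  volume.withDensity fun x => ENNReal.ofReal (m x)

/-- The space `L²_μ(ℝᴺ)` of complex-valued functions, `dμ = m dx`. -/
abbrev L2mu (m : EuclideanSpace ℝ (Fin N) → ℝ) : Type := Lp ℂ 2 (densityMeasure m)

/-- `L φ = Δ φ + (∇m / m) · ∇ φ`, the last term being the derivative of `φ` in the direction
`∇m / m`, where `g = ∇m`. -/
def kolmogorovExpr (m : EuclideanSpace ℝ (Fin N) → ℝ)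
    (g : EuclideanSpace ℝ (Fin N) → EuclideanSpace ℝ (Fin N))
    (φ : EuclideanSpace ℝ (Fin N) → ℂ) (x : EuclideanSpace ℝ (Fin N)) : ℂ :=
  (Δ φ) x + fderiv ℝ φ x ((m x)⁻¹ • g x)

/-- The graph of `(L, C_c^∞(ℝᴺ))` in `L²_μ(ℝᴺ)`. -/
def kolmogorovCoreGraph (m : EuclideanSpace ℝ (Fin N) → ℝ)
    (g : EuclideanSpace ℝ (Fin N) → EuclideanSpace ℝ (Fin N)) :
    Submodule ℂ (L2mu m × L2mu m) where
  carrier := {p | ∃ φ : EuclideanSpace ℝ (Fin N) → ℂ, IsTestFunction φ ∧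
    p.1 =ᵐ[densityMeasure m] φ ∧ p.2 =ᵐ[densityMeasure m] kolmogorovExpr m g φ}
  add_mem' := by
    rintro ⟨u, w⟩ ⟨u', w'⟩ ⟨φ, hφ, h1, h2⟩ ⟨ψ, hψ, h3, h4⟩
    refine ⟨φ + ψ, ⟨hφ.1.add hψ.1, hφ.2.add hψ.2⟩, ?_, ?_⟩
    · filter_upwards [Lp.coeFn_add u u', h1, h3] with x hx hx1 hx3
      simp only [Prod.mk_add_mk, hx, Pi.add_apply, hx1, hx3]
    · filter_upwards [Lp.coeFn_add w w', h2, h4] with x hx hx2 hx4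
      have dφ : DifferentiableAt ℝ φ x := hφ.1.differentiable (by simp) x
      have dψ : DifferentiableAt ℝ ψ x := hψ.1.differentiable (by simp) x
      have cφ : ContDiffAt ℝ 2 φ x := (contDiff_infty.1 hφ.1 2).contDiffAt
      have cψ : ContDiffAt ℝ 2 ψ x := (contDiff_infty.1 hψ.1 2).contDiffAt
      simp only [Prod.mk_add_mk, hx, Pi.add_apply, hx2, hx4, kolmogorovExpr,
        cφ.laplacian_add cψ, fderiv_add dφ dψ, _root_.add_apply]
      ring
  zero_mem' := by
    refine ⟨0, ⟨contDiff_const, HasCompactSupport.zero⟩, Lp.coeFn_zero _ _ _, ?_⟩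
    filter_upwards [Lp.coeFn_zero ℂ 2 (densityMeasure m)] with x hx
    have e : (0 : EuclideanSpace ℝ (Fin N) → ℂ) = fun _ => 0 := rfl
    exact hx.trans (by simp [kolmogorovExpr, e])
  smul_mem' := by
    rintro c ⟨u, w⟩ ⟨φ, hφ, h1, h2⟩
    refine ⟨c • φ, ⟨contDiff_const.smul hφ.1, hφ.2.smul_left (f := fun _ => c)⟩, ?_, ?_⟩
    · filter_upwards [Lp.coeFn_smul c u, h1] with x hx hx1
      simp only [Prod.smul_mk, hx, Pi.smul_apply, hx1]
    · filter_upwards [Lp.coeFn_smul c w, h2] with x hx hx2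
      have dφ : DifferentiableAt ℝ φ x := hφ.1.differentiable (by simp) x
      have cφ : ContDiffAt ℝ 2 φ x := (contDiff_infty.1 hφ.1 2).contDiffAt
      simp only [Prod.smul_mk, hx, Pi.smul_apply, hx2, kolmogorovExpr,
        InnerProductSpace.laplacian_smul c cφ, fderiv_const_smul dφ c,
        _root_.smul_apply, smul_add]

/-- The operator `(L, D(L))`: the closure of `(L, C_c^∞(ℝᴺ))` in `L²_μ(ℝᴺ)`. -/
def kolmogorovOperator (m : EuclideanSpace ℝ (Fin N) → ℝ)
    (g : EuclideanSpace ℝ (Fin N) → EuclideanSpace ℝ (Fin N)) : L2mu m →ₗ.[ℂ] L2mu m :=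
  (kolmogorovCoreGraph m g).toLinearPMap.closure

/-- The bi-Kolmogorov operator `(A, D(A))`: the operator associated to the form
`a_L(u, v) = ∫ L u \overline{L v} dμ`, `D(a_L) = D(L)`. -/
def biKolmogorovOperator (m : EuclideanSpace ℝ (Fin N) → ℝ)
    (g : EuclideanSpace ℝ (Fin N) → EuclideanSpace ℝ (Fin N)) : L2mu m →ₗ.[ℂ] L2mu m :=
  squareFormOperator (kolmogorovOperator m g)

/-- The function `χ_K f` as an element of `L²_μ(ℝᴺ)`. -/
def cutoff {m : EuclideanSpace ℝ (Fin N) → ℝ} {K : Set (EuclideanSpace ℝ (Fin N))}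
    (hK : IsCompact K) (f : L2mu m) : L2mu m :=
  ((Lp.memLp f).indicator hK.measurableSet).toLp _

/-- The restriction of `f` to `K` lies in `L²_μ(K)_>`: it is real and nonnegative a.e. on `K`, and
positive on a subset of `K` of positive Lebesgue measure. On `ℂ` the order is `z ≤ w` iff
`Re z ≤ Re w` and `Im z = Im w`. -/
def IsPositiveOn {m : EuclideanSpace ℝ (Fin N) → ℝ} (K : Set (EuclideanSpace ℝ (Fin N)))
    (f : L2mu m) : Prop :=
  (∀ᵐ x ∂volume.restrict K, 0 ≤ f x) ∧ 0 < volume {x ∈ K | 0 < f x}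

/-- A family `(T t)_{t ≥ 0}` on `L²_μ(ℝᴺ)` is locally uniformly eventually positive: for compact
`K` there is `t₀ > 0` such that every `f` which is positive on `K` admits `c > 0` with
`T t (χ_K f) ≥ c` a.e. on `K` for all `t ≥ t₀`. -/
def IsLocallyUniformlyEventuallyPositive {m : EuclideanSpace ℝ (Fin N) → ℝ}
    (T : ℝ → L2mu m →L[ℂ] L2mu m) : Prop :=
  ∀ (K : Set (EuclideanSpace ℝ (Fin N))) (hK : IsCompact K),
    ∃ t₀ : ℝ, 0 < t₀ ∧ ∀ f : L2mu m, IsPositiveOn K f →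
      ∃ c : ℝ, 0 < c ∧ ∀ t : ℝ, t₀ ≤ t →
        ∀ᵐ x ∂volume.restrict K, (c : ℂ) ≤ T t (cutoff hK f) x

end Kolmogorov

end

/-! Put R = (1 + A)⁻¹. Since the form is nonnegative and L is closed, R is self-adjoint with
spectrum in [0, 1] and A = R⁻¹ - 1, so everything reduces to the functional calculus of the bounded
operator R. The semigroup is the function exp(-t(1/s - 1)) evaluated at R.

Because 0 is isolated in σ(-A), the point 1 is isolated in σ(R), and `exists_projection_add_decay`
splits e^{-tA} = P + Rⁿ S(t) Rⁿ with ‖S(t)‖ → 0. The powers of R can be pulled out since exp(-t/s)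
vanishes to infinite order at s = 0. The range of P is ker A. There Au = 0 forces Lu = 0, hence a
vanishing weak gradient, hence u constant (`exists_ae_eq_const_of_kolmogorovOperator_eq_zero`). As μ
is a probability measure, Pf = ∫ f dμ.

The operator Rⁿ maps L²_μ into D(Aⁿ) ⊂ L^∞_loc. By duality and uniform boundedness, ‖Rⁿk‖₂ ≤ C_K
‖k‖₁ for every k supported in K (`exists_norm_le_integral_norm`). Thus for measurable s ⊂ K the
pairing of 1_s with e^{-tA}(χ_K f) differs from ‖χ_K f‖₁ μ(s) by at most C_K² ‖S(t)‖ ‖χ_K f‖₁ μ(s).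
Main term and error scale by the same L¹ norm, so the threshold in t depends on K alone and c = ‖χ_K
f‖₁ / 2 works. The function is real because A commutes with complex conjugation. -/

/-! ### The resolvent (1 + L*L)⁻¹ from the graph of L -/

section SquareForm

variable {H : Type*} [NormedAddCommGroup H] [InnerProductSpace ℂ H]

/-- The graph of `L` as a subspace of the Hilbert space `H ⊕ H`. -/
def hilbertGraph (L : H →ₗ.[ℂ] H) : Submodule ℂ (WithLp 2 (H × H)) :=
  L.graph.comap (WithLp.linearEquiv 2 ℂ (H × H)).toLinearMap

theorem isClosed_hilbertGraph {L : H →ₗ.[ℂ] H} (hL : L.IsClosed) :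
    IsClosed (hilbertGraph L : Set (WithLp 2 (H × H))) :=
  IsClosed.preimage (WithLp.prod_continuous_ofLp 2 H H) hL

/-- The projection of the graph of `L` onto `D(L)`. -/
def hilbertGraphFst (L : H →ₗ.[ℂ] H) : hilbertGraph L →L[ℂ] H :=
  (WithLp.fstL 2 ℂ H H).comp (hilbertGraph L).subtypeL

/-- For a closed densely defined `L`, the operator `(1 + L* L)⁻¹` is a self-adjoint operator
with spectrum in `[0, 1]`. -/
theorem exists_resolvent_squareFormOperator [CompleteSpace H] {L : H →ₗ.[ℂ] H}
    (hL : L.IsClosed) (hd : Dense (L.domain : Set H)) :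
    ∃ R : H →L[ℂ] H, IsSelfAdjoint R ∧ spectrum ℝ R ⊆ Set.Icc 0 1 ∧
      ∀ u w : H, (u, w) ∈ (squareFormOperator L).graph ↔ R (u + w) = u := by
  have : CompleteSpace (hilbertGraph L) :=
    (isClosed_hilbertGraph hL).completeSpace_coe
  set P := hilbertGraphFst L with hP
  have hP1 : ‖P‖ ≤ 1 := by
    refine P.opNorm_le_bound zero_le_one fun x => ?_
    rw [one_mul]
    exact WithLp.norm_fst_le _ _
  -- P* f is the Riesz representative, in the graph inner product, of v ↦ ⟨f, v⟩. Its first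
  -- component R f is therefore the weak solution of u + L*L u = f, and its second component is L R
  -- f.
  set R : H →L[ℂ] H := P.comp P.adjoint with hR
  have hsa : IsSelfAdjoint R := by
    rw [ContinuousLinearMap.isSelfAdjoint_iff', hR, ContinuousLinearMap.adjoint_comp,
      ContinuousLinearMap.adjoint_adjoint]
  have hpos : R.IsPositive := by
    simpa [hR] using ContinuousLinearMap.isPositive_self_comp_adjoint P
  have hn : ‖R‖ ≤ 1 := by
    refine (ContinuousLinearMap.opNorm_comp_le _ _).trans ?_
    rw [LinearIsometryEquiv.norm_map]
    nlinarith [norm_nonneg P]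
  set S : H → H := fun f => ((P.adjoint f : hilbertGraph L) : WithLp 2 (H × H)).snd with hS
  have key : ∀ (f : H) (v : L.domain), inner ℂ (v : H) (R f) + inner ℂ (L v) (S f)
      = inner ℂ (v : H) f := by
    intro f v
    let p : hilbertGraph L := ⟨WithLp.toLp 2 ((v : H), L v), by
      change ((v : H), L v) ∈ L.graph
      exact L.mem_graph v⟩
    have h := ContinuousLinearMap.adjoint_inner_right P p f
    rw [Submodule.coe_inner, WithLp.prod_inner_apply] at h
    exact h
  have hgr : ∀ f : H, ∃ hf : R f ∈ L.domain, L ⟨R f, hf⟩ = S f := by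
    intro f
    have h : (R f, S f) ∈ L.graph := (P.adjoint f).2
    obtain ⟨⟨y, hy⟩, h1, h2⟩ := (LinearPMap.mem_graph_iff L).1 h
    simp only at h1 h2
    subst h1
    exact ⟨hy, h2⟩
  refine ⟨R, hsa, fun x hx => ⟨?_, ?_⟩, fun u w => ?_⟩
  · have h0 : 0 ≤ R := by rwa [ContinuousLinearMap.nonneg_iff_isPositive]
    exact spectrum_nonneg_of_nonneg h0 hx
  · have := (spectrum.norm_le_norm_mul_of_mem (𝕜 := ℝ) hx)
    have h1 : ‖(1 : H →L[ℂ] H)‖ ≤ 1 := ContinuousLinearMap.norm_id_le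
    have h2 : ‖R‖ * ‖(1 : H →L[ℂ] H)‖ ≤ 1 := mul_le_one₀ hn (norm_nonneg _) h1
    exact (le_abs_self x).trans (this.trans h2)
  · rw [squareFormOperator_graph L hd]
    obtain ⟨hd3, he⟩ := hgr (u + w)
    constructor
    · rintro ⟨hu, h⟩
      have hd2 : ∀ v : L.domain, inner ℂ (v : H) (u - R (u + w)) +
          inner ℂ (L v) (L ⟨u, hu⟩ - S (u + w)) = 0 := by
        intro v
        have h1 := h v
        have h2 := key (u + w) v
        simp only [squareForm] at h1
        rw [inner_add_right] at h2
        rw [inner_sub_right, inner_sub_right, h1]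
        linear_combination -h2
      -- Uniqueness of the weak solution: testing with the difference itself leaves a vanishing sum
      -- of two squares.
      have h3 := hd2 (⟨u, hu⟩ - ⟨R (u + w), hd3⟩)
      rw [LinearPMap.map_sub, he, Submodule.coe_sub, inner_self_eq_norm_sq_to_K,
        inner_self_eq_norm_sq_to_K] at h3
      have h4 : ‖u - R (u + w)‖ ^ 2 + ‖L ⟨u, hu⟩ - S (u + w)‖ ^ 2 = 0 := by
        refine Complex.ofReal_eq_zero.1 ?_
        rw [Complex.ofReal_add, Complex.ofReal_pow, Complex.ofReal_pow]
        exact h3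
      have h5 : ‖u - R (u + w)‖ ^ 2 = 0 := by
        nlinarith [sq_nonneg ‖u - R (u + w)‖, sq_nonneg ‖L ⟨u, hu⟩ - S (u + w)‖]
      exact (sub_eq_zero.1 (norm_eq_zero.1 (pow_eq_zero_iff two_ne_zero |>.1 h5))).symm
    · intro h
      have hu : u ∈ L.domain := h ▸ hd3
      have he' : L ⟨u, hu⟩ = S (u + w) := by rw [← he]; congr 2; exact h.symm
      refine ⟨hu, fun v => ?_⟩
      have h3 := key (u + w) v
      rw [h, inner_add_right] at h3
      rw [squareForm, he']
      exact add_left_cancel h3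

end SquareForm

/-! ### The scalar function behind the semigroup -/

noncomputable section ExpSymbol

/-- The function `s ↦ exp (-t (1/s - 1))`, extended by zero to `s ≤ 0`. -/
def expSymbol (t s : ℝ) : ℝ := Real.exp t * expNegInvGlue (s / t)

theorem expSymbol_zero_right (t : ℝ) : expSymbol t 0 = 0 := by simp [expSymbol]

theorem expSymbol_of_pos {t s : ℝ} (ht : 0 < t) (hs : 0 < s) :
    expSymbol t s = Real.exp (-(t * (s⁻¹ - 1))) := by
  have : ¬ s / t ≤ 0 := not_le.2 (div_pos hs ht)
  rw [expSymbol, expNegInvGlue, if_neg this, ← Real.exp_add]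
  congr 1
  field_simp
  ring

theorem continuous_expSymbol (t : ℝ) : Continuous (expSymbol t) :=
  continuous_const.mul
    ((expNegInvGlue.contDiff (n := 0)).continuous.comp (continuous_id.div_const t))

/-- The infinite-order zero at s = 0 absorbs any power of 1/s, and the convention 0⁻¹ = 0 agrees
with the limit. This is what later allows powers of R to be factored out. -/
theorem continuous_expSymbol_mul_inv_pow {t : ℝ} (ht : 0 < t) (k : ℕ) :
    Continuous fun s => expSymbol t s * s⁻¹ ^ k := by
  have h := (expNegInvGlue.continuous_polynomial_eval_inv_mul (Polynomial.X ^ k)).comp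
    (continuous_id.div_const t)
  have e : (fun s => expSymbol t s * s⁻¹ ^ k) = fun s => (Real.exp t * t⁻¹ ^ k) *
      ((fun x => (Polynomial.X ^ k : Polynomial ℝ).eval x⁻¹ * expNegInvGlue x) ∘
        fun s => id s / t) s := by
    funext s
    simp only [expSymbol, Function.comp, id, Polynomial.eval_pow, Polynomial.eval_X, inv_div,
      div_pow, inv_pow]
    field_simp
  rw [e]
  exact continuous_const.mul h

theorem expSymbol_mem_Icc {t s : ℝ} (ht : 0 < t) (hs : s ∈ Set.Icc (0 : ℝ) 1) :
    expSymbol t s ∈ Set.Icc (0 : ℝ) 1 := by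
  rcases hs.1.eq_or_lt with rfl | h0
  · simp [expSymbol_zero_right]
  · rw [expSymbol_of_pos ht h0]
    refine ⟨(Real.exp_pos _).le, Real.exp_le_one_iff.2 ?_⟩
    have : 1 ≤ s⁻¹ := (one_le_inv₀ h0).2 hs.2
    have := mul_nonneg ht.le (sub_nonneg.2 this)
    linarith

theorem expSymbol_add {t t' s : ℝ} (ht : 0 < t) (ht' : 0 < t') (hs : 0 ≤ s) :
    expSymbol (t + t') s = expSymbol t s * expSymbol t' s := by
  rcases hs.eq_or_lt with rfl | h0
  · simp [expSymbol_zero_right]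
  · rw [expSymbol_of_pos ht h0, expSymbol_of_pos ht' h0, expSymbol_of_pos (add_pos ht ht') h0,
      ← Real.exp_add]
    congr 1
    ring

/-- The extra factor s compensates the unbounded exponent 1/s - 1. It yields strong continuity on
the range of R. -/
theorem abs_expSymbol_sub_one_mul_le {t s : ℝ} (ht : 0 < t) (hs : s ∈ Set.Icc (0 : ℝ) 1) :
    |(expSymbol t s - 1) * s| ≤ t := by
  rcases hs.1.eq_or_lt with rfl | h0
  · simp [ht.le]
  · have h1 := expSymbol_mem_Icc ht hs
    rw [abs_mul, abs_of_nonneg hs.1, abs_of_nonpos (by linarith [h1.2])]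
    rw [expSymbol_of_pos ht h0]
    have h2 := Real.add_one_le_exp (-(t * (s⁻¹ - 1)))
    calc _ ≤ (t * (s⁻¹ - 1)) * s := by gcongr; linarith
      _ = t * (1 - s) := by field_simp
      _ ≤ t := by nlinarith [hs.1]

theorem abs_exp_neg_sub_one_add_le {y : ℝ} (hy : 0 ≤ y) : |Real.exp (-y) - 1 + y| ≤ y ^ 2 := by
  have h2 := Real.add_one_le_exp (-y)
  rw [abs_of_nonneg (by linarith)]
  rcases le_or_gt y 1 with h | h
  · have := Real.abs_exp_sub_one_sub_id_le (x := -y) (by rw [abs_neg, abs_of_nonneg hy]; exact h)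
    have := (le_abs_self _).trans this
    nlinarith
  · have : Real.exp (-y) ≤ 1 := Real.exp_le_one_iff.2 (by linarith)
    nlinarith

/-- The Taylor remainder is quadratic in 1/s - 1, so two factors s are needed. It identifies the
generator on a dense set. -/
theorem abs_expSymbol_diffQuot_le {t s : ℝ} (ht : 0 < t) (hs : s ∈ Set.Icc (0 : ℝ) 1) :
    |(t⁻¹ * ((expSymbol t s - 1) * s) + (1 - s)) * s| ≤ t := by
  rcases hs.1.eq_or_lt with rfl | h0
  · simp [ht.le]
  · rw [expSymbol_of_pos ht h0]
    have h1 : 0 ≤ t * (s⁻¹ - 1) :=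
      mul_nonneg ht.le (sub_nonneg.2 ((one_le_inv₀ h0).2 hs.2))
    have h2 := abs_exp_neg_sub_one_add_le h1
    have e : (t⁻¹ * ((Real.exp (-(t * (s⁻¹ - 1))) - 1) * s) + (1 - s)) * s =
        (t⁻¹ * s ^ 2) * (Real.exp (-(t * (s⁻¹ - 1))) - 1 + t * (s⁻¹ - 1)) := by
      field_simp
    rw [e, abs_mul, abs_of_nonneg (by positivity)]
    calc _ ≤ (t⁻¹ * s ^ 2) * (t * (s⁻¹ - 1)) ^ 2 := by gcongr
      _ = t * (1 - s) ^ 2 := by field_simp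
      _ ≤ t := mul_le_of_le_one_right ht.le (by nlinarith [hs.1, hs.2])

end ExpSymbol

/-! ### The semigroup generated by 1 - R⁻¹ -/

noncomputable section Semigroup

variable {H : Type*} [NormedAddCommGroup H] [InnerProductSpace ℂ H]

theorem tendsto_apply_of_dense {ι : Type*} {l : Filter ι} {B : ι → H →L[ℂ] H} {B' : H →L[ℂ] H}
    {C : ℝ} (hB : ∀ᶠ i in l, ‖B i‖ ≤ C) {D : Set H} (hD : Dense D)
    (h : ∀ x ∈ D, Tendsto (fun i => B i x) l (𝓝 (B' x))) (x : H) :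
    Tendsto (fun i => B i x) l (𝓝 (B' x)) := by
  rw [Metric.tendsto_nhds]
  intro ε hε
  set M := |C| + ‖B'‖ + 1 with hM
  have hMpos : 0 < M := by positivity
  obtain ⟨y, hy, hxy⟩ := Metric.dense_iff.1 hD x (ε / 2 / M) (by positivity)
  rw [Metric.mem_ball, dist_comm, dist_eq_norm] at hy
  filter_upwards [hB, Metric.tendsto_nhds.1 (h y hxy) (ε / 2) (by positivity)] with i hi hi2
  rw [dist_eq_norm] at hi2 ⊢
  have e : B i x - B' x = B i (x - y) - B' (x - y) + (B i y - B' y) := by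
    simp only [map_sub]; abel
  have h1 : ‖B i (x - y)‖ ≤ |C| * ‖x - y‖ :=
    (B i).le_of_opNorm_le (hi.trans (le_abs_self C)) _
  have h2 := B'.le_opNorm (x - y)
  have h3 : M * ‖x - y‖ < ε / 2 := by
    rwa [lt_div_iff₀ hMpos, mul_comm] at hy
  rw [e]
  have h4 := norm_add_le (B i (x - y) - B' (x - y)) (B i y - B' y)
  have h5 := norm_sub_le (B i (x - y)) (B' (x - y))
  rw [hM] at h3
  nlinarith [norm_nonneg (x - y)]

theorem tendsto_zero_of_norm_le_id {B : ℝ → H →L[ℂ] H} (hB : ∀ t, 0 < t → ‖B t‖ ≤ t) (x : H) :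
    Tendsto (fun t => B t x) (𝓝[>] 0) (𝓝 0) := by
  have h0 : Tendsto (fun t : ℝ => t * ‖x‖) (𝓝[>] 0) (𝓝 0) := by
    have : Tendsto (fun t : ℝ => t * ‖x‖) (𝓝 0) (𝓝 (0 * ‖x‖)) := tendsto_id.mul_const _
    rw [zero_mul] at this
    exact this.mono_left nhdsWithin_le_nhds
  refine squeeze_zero_norm' ?_ h0
  filter_upwards [self_mem_nhdsWithin] with t ht
  exact (B t).le_of_opNorm_le (hB t ht) x

variable [CompleteSpace H] {R : H →L[ℂ] H}

/-- The orthogonal complement of the range is the kernel of the adjoint, here R itself. -/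
theorem dense_range_of_isSelfAdjoint (hR : IsSelfAdjoint R) (hinj : ∀ x, R x = 0 → x = 0) :
    Dense (Set.range R) := by
  have h : (LinearMap.range R.toLinearMap)ᗮ = ⊥ := by
    rw [eq_bot_iff]
    intro x hx
    rw [Submodule.mem_orthogonal] at hx
    refine hinj x (ext_inner_left ℂ fun v => ?_)
    rw [inner_zero_right, ← ContinuousLinearMap.adjoint_inner_left,
      ContinuousLinearMap.isSelfAdjoint_iff'.1 hR]
    exact hx _ ⟨v, rfl⟩
  have := Submodule.dense_iff_topologicalClosure_eq_top.2
    ((Submodule.topologicalClosure_eq_top_iff).2 h)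
  rwa [LinearMap.coe_range] at this

/-- The operators `exp (-t (R⁻¹ - 1))`. -/
def resolventSemigroup (R : H →L[ℂ] H) (t : ℝ) : H →L[ℂ] H :=
  -- The value at t = 0 is set by hand: `expSymbol 0` is identically 0, because division by zero
  -- gives 0.
  if t ≤ 0 then 1 else cfc (expSymbol t) R

theorem resolventSemigroup_of_pos (R : H →L[ℂ] H) {t : ℝ} (ht : 0 < t) :
    resolventSemigroup R t = cfc (expSymbol t) R := if_neg (not_le.2 ht)

theorem resolventSemigroup_zero (R : H →L[ℂ] H) : resolventSemigroup R 0 = 1 := if_pos le_rfl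

theorem resolventSemigroup_add (hs : spectrum ℝ R ⊆ Set.Icc 0 1) {s t : ℝ}
    (h0 : 0 ≤ s) (h1 : 0 ≤ t) :
    resolventSemigroup R (s + t) = resolventSemigroup R s * resolventSemigroup R t := by
  rcases h0.eq_or_lt with rfl | h0
  · rw [zero_add, resolventSemigroup_zero, one_mul]
  rcases h1.eq_or_lt with rfl | h1
  · rw [add_zero, resolventSemigroup_zero, mul_one]
  rw [resolventSemigroup_of_pos R (add_pos h0 h1), resolventSemigroup_of_pos R h0,
    resolventSemigroup_of_pos R h1, ← cfc_mul _ _ R (continuous_expSymbol s).continuousOn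
    (continuous_expSymbol t).continuousOn]
  exact cfc_congr fun x hx => expSymbol_add h0 h1 (hs hx).1

theorem norm_resolventSemigroup_sub_one_mul_le (hR : IsSelfAdjoint R)
    (hs : spectrum ℝ R ⊆ Set.Icc 0 1) {t : ℝ} (ht : 0 < t) :
    ‖(resolventSemigroup R t - 1) * R‖ ≤ t := by
  have hc := (continuous_expSymbol t).continuousOn (s := spectrum ℝ R)
  have e : (resolventSemigroup R t - 1) * R = cfc (fun s => (expSymbol t s - 1) * s) R := by
    rw [cfc_mul (fun s => expSymbol t s - 1) (fun s => s) R, cfc_id' ℝ R,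
      cfc_sub (expSymbol t) (fun _ => 1) R, cfc_const_one ℝ R, resolventSemigroup_of_pos R ht]
  rw [e]
  exact norm_cfc_le ht.le fun x hx => abs_expSymbol_sub_one_mul_le ht (hs hx)

theorem norm_resolventSemigroup_le (hs : spectrum ℝ R ⊆ Set.Icc 0 1) {t : ℝ} (ht : 0 < t) :
    ‖resolventSemigroup R t‖ ≤ 1 := by
  rw [resolventSemigroup_of_pos R ht]
  refine norm_cfc_le zero_le_one fun x hx => ?_
  have := expSymbol_mem_Icc ht (hs hx)
  rw [Real.norm_eq_abs, abs_of_nonneg this.1]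
  exact this.2

theorem norm_resolventSemigroup_diffQuot_le (hR : IsSelfAdjoint R)
    (hs : spectrum ℝ R ⊆ Set.Icc 0 1) {t : ℝ} (ht : 0 < t) :
    ‖(t⁻¹ • ((resolventSemigroup R t - 1) * R) + (1 - R)) * R‖ ≤ t := by
  have hc := (continuous_expSymbol t).continuousOn (s := spectrum ℝ R)
  have e : (t⁻¹ • ((resolventSemigroup R t - 1) * R) + (1 - R)) * R =
      cfc (fun s => (t⁻¹ * ((expSymbol t s - 1) * s) + (1 - s)) * s) R := by
    rw [cfc_mul (fun s => t⁻¹ * ((expSymbol t s - 1) * s) + (1 - s)) (fun s => s) R, cfc_id' ℝ R,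
      cfc_add R (fun s => t⁻¹ * ((expSymbol t s - 1) * s)) (fun s => 1 - s),
      cfc_const_mul t⁻¹ (fun s => (expSymbol t s - 1) * s) R,
      cfc_mul (fun s => expSymbol t s - 1) (fun s => s) R, cfc_id' ℝ R,
      cfc_sub (expSymbol t) (fun _ => 1) R, cfc_const_one ℝ R, resolventSemigroup_of_pos R ht,
      cfc_sub (fun _ => 1) (fun s => s) R, cfc_const_one ℝ R, cfc_id' ℝ R]
  rw [e]
  exact norm_cfc_le ht.le fun x hx => abs_expSymbol_diffQuot_le ht (hs hx)

theorem tendsto_resolventSemigroup (hR : IsSelfAdjoint R) (hs : spectrum ℝ R ⊆ Set.Icc 0 1)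
    (hinj : ∀ x, R x = 0 → x = 0) (x : H) :
    Tendsto (fun t => resolventSemigroup R t x) (𝓝[>] 0) (𝓝 x) := by
  refine tendsto_apply_of_dense (B' := 1) (C := 1) ?_ (dense_range_of_isSelfAdjoint hR hinj) ?_ x
  · filter_upwards [self_mem_nhdsWithin] with t ht using norm_resolventSemigroup_le hs ht
  · rintro _ ⟨y, rfl⟩
    have := (tendsto_zero_of_norm_le_id (fun t ht =>
      norm_resolventSemigroup_sub_one_mul_le hR hs ht) y).add_const (R y)
    simpa using this

theorem tendsto_resolventSemigroup_diffQuot (hR : IsSelfAdjoint R)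
    (hs : spectrum ℝ R ⊆ Set.Icc 0 1) (hinj : ∀ x, R x = 0 → x = 0) (x : H) :
    Tendsto (fun t : ℝ => (t⁻¹ • ((resolventSemigroup R t - 1) * R)) x) (𝓝[>] 0)
      (𝓝 (R x - x)) := by
  refine tendsto_apply_of_dense (B' := R - 1) (C := 1) ?_
    (dense_range_of_isSelfAdjoint hR hinj) ?_ x
  · filter_upwards [self_mem_nhdsWithin] with t ht
    have ht : 0 < t := ht
    rw [norm_smul, norm_inv, Real.norm_of_nonneg ht.le, inv_mul_le_iff₀ ht, mul_one]
    exact norm_resolventSemigroup_sub_one_mul_le hR hs ht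
  · rintro _ ⟨y, rfl⟩
    have := (tendsto_zero_of_norm_le_id (fun t ht =>
      norm_resolventSemigroup_diffQuot_le hR hs ht) y).add_const (R (R y) - R y)
    rw [zero_add] at this
    refine this.congr fun t => ?_
    simp only [mul_apply_eq_comp, _root_.add_apply, _root_.sub_apply,
      one_apply_eq_self]
    abel

theorem commute_resolventSemigroup (hR : IsSelfAdjoint R) (t : ℝ) :
    Commute (resolventSemigroup R t) R := by
  unfold resolventSemigroup
  split_ifs
  · exact Commute.one_left R
  · simpa only [cfc_id ℝ R] using cfc_commute_cfc (expSymbol t) id R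

/-- If `G = 1 - R⁻¹`, then the operators `exp (-t (R⁻¹ - 1))` form the `C₀`-semigroup generated
by `G`. -/
theorem isC0SemigroupGeneratedBy_resolventSemigroup (hR : IsSelfAdjoint R)
    (hs : spectrum ℝ R ⊆ Set.Icc 0 1) {G : H →ₗ.[ℂ] H}
    (hG : ∀ u w, (u, w) ∈ G.graph ↔ R (u - w) = u) :
    IsC0SemigroupGeneratedBy (resolventSemigroup R) G := by
  have hinj : ∀ x, R x = 0 → x = 0 := by
    intro x hx
    have h : ((0 : H), -x) ∈ G.graph := (hG _ _).2 (by simpa using hx)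
    exact neg_eq_zero.1 (G.graph_fst_eq_zero_snd h rfl)
  refine ⟨resolventSemigroup_zero R, fun s t h0 h1 => resolventSemigroup_add hs h0 h1,
    tendsto_resolventSemigroup hR hs hinj, fun x y => ?_⟩
  have hcomm : ∀ (t : ℝ) (z : H), resolventSemigroup R t (R z) = R (resolventSemigroup R t z) :=
    fun t z => congrArg (fun B : H →L[ℂ] H => B z) (commute_resolventSemigroup hR t).eq
  have hq : ∀ (t : ℝ) (z : H), (t⁻¹ • ((resolventSemigroup R t - 1) * R)) z =
      (t : ℂ)⁻¹ • (resolventSemigroup R t (R z) - R z) := by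
    intro t z
    rw [← Complex.ofReal_inv, Complex.coe_smul]
    simp
  rw [hG]
  constructor
  · intro h
    have h2 := tendsto_resolventSemigroup_diffQuot hR hs hinj (x - y)
    simp only [hq, h] at h2
    simpa using h2
  -- Applying R, which commutes with the semigroup, turns the assumed limit into R y = R x - x, that
  -- is R (x - y) = x.
  · intro h
    have h2 := tendsto_resolventSemigroup_diffQuot hR hs hinj x
    simp only [hq, hcomm] at h2
    have h3 := (R.continuous.tendsto y).comp h
    have h4 : R y = R x - x := by
      refine tendsto_nhds_unique h3 (h2.congr fun t => ?_)
      simp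
    rw [map_sub, h4]
    abel

end Semigroup

/-! ### Powers, spectrum and spectral gap in terms of R -/

section Resolvent

variable {H : Type*} [NormedAddCommGroup H] [InnerProductSpace ℂ H] {R : H →L[ℂ] H}

/-- Since A R = 1 - R, one has A Rⁿ⁺¹x = Rⁿ(x - R x), which is again a value of Rⁿ. -/
theorem memPowDomain_pow_apply {A : H →ₗ.[ℂ] H}
    (hA : ∀ u w, (u, w) ∈ A.graph ↔ R (u + w) = u) (n : ℕ) (x : H) :
    MemPowDomain A n ((R ^ n) x) := by
  induction n generalizing x with
  | zero => trivial
  | succ n ih =>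
    have h : ((R ^ (n + 1)) x, (R ^ n) (x - R x)) ∈ A.graph := by
      rw [hA, map_sub, ← mul_apply_eq_comp (R ^ n) R, ← pow_succ, add_sub_cancel, pow_succ']
      rfl
    obtain ⟨y, hy, h2⟩ := (LinearPMap.mem_graph_iff A).1 h
    simp only at hy h2
    refine ⟨hy ▸ y.2, ?_⟩
    have e : (⟨(R ^ (n + 1)) x, hy ▸ y.2⟩ : A.domain) = y := Subtype.ext hy.symm
    rw [e, h2]
    exact ih _

/-- With G = 1 - R⁻¹ the operator is (z - G) R, and its inverse is (1 - G)(z - G)⁻¹ = 1 + (1 - z)(z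
- G)⁻¹. -/
theorem isUnit_one_sub_smul_of_mem_resolventSet {G : H →ₗ.[ℂ] H}
    (hG : ∀ u w, (u, w) ∈ G.graph ↔ R (u - w) = u) {z : ℝ}
    (hz : (z : ℂ) ∈ operatorResolventSet G) : IsUnit (1 - (1 - z) • R) := by
  obtain ⟨B, hB1, hB2⟩ := hz
  have h1 : ∀ x, R (x + (1 - z) • B x) = B x := by
    intro x
    obtain ⟨hx, h⟩ := hB1 x
    have h2 := (hG _ _).1 (G.mem_graph ⟨B x, hx⟩)
    have e : x + (1 - z) • B x = B x - G ⟨B x, hx⟩ := by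
      rw [Complex.coe_smul] at h
      nth_rewrite 1 [← h]
      module
    rw [e]
    exact h2
  have h3 : ∀ x, B x = R x + (1 - z) • B (R x) := by
    intro x
    have h : (R x, R x - x) ∈ G.graph := (hG _ _).2 (by simp)
    obtain ⟨y, hy, h2⟩ := (LinearPMap.mem_graph_iff G).1 h
    simp only at hy h2
    have h4 := hB2 y
    rw [h2, hy, Complex.coe_smul] at h4
    have e : z • R x - (R x - x) = x - (1 - z) • R x := by module
    rw [e, map_sub, ContinuousLinearMap.map_smul_of_tower] at h4
    exact sub_eq_iff_eq_add.1 h4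
  refine ⟨⟨1 - (1 - z) • R, 1 + (1 - z) • B, ?_, ?_⟩, rfl⟩
  · ext x
    have := h1 x
    simp only [mul_apply_eq_comp, _root_.add_apply, _root_.sub_apply, one_apply_eq_self,
      _root_.smul_apply, this]
    abel
  · ext x
    have := h3 x
    simp only [mul_apply_eq_comp, _root_.add_apply, _root_.sub_apply, one_apply_eq_self,
      _root_.smul_apply, map_sub, ContinuousLinearMap.map_smul_of_tower]
    nth_rewrite 1 [this]
    module

/-- From -G = (1 - R) R⁻¹: an inverse C of 1 - R would make C R an inverse of -G. -/
theorem one_mem_spectrum_of_zero_mem {G : H →ₗ.[ℂ] H}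
    (hG : ∀ u w, (u, w) ∈ G.graph ↔ R (u - w) = u) (h0 : (0 : ℂ) ∈ operatorSpectrum G) :
    (1 : ℝ) ∈ spectrum ℝ R := by
  by_contra h
  refine h0 ?_
  rw [spectrum.notMem_iff, map_one] at h
  obtain ⟨⟨a, C, h1, h2⟩, rfl : a = 1 - R⟩ := h
  have h1' : ∀ x, C x - R (C x) = x := fun x => by
    simpa using congrArg (fun B : H →L[ℂ] H => B x) h1
  have h2' : ∀ x, C x - C (R x) = x := fun x => by
    simpa using congrArg (fun B : H →L[ℂ] H => B x) h2
  refine ⟨C * R, fun x => ?_, fun x => ?_⟩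
  · have e : C (R x) = R (C x) := by
      have := (h1' x).trans (h2' x).symm
      exact (sub_right_injective this).symm
    have h : ((C * R) x, -x) ∈ G.graph := by
      rw [hG, mul_apply_eq_comp, e]
      congr 1
      rw [sub_neg_eq_add]
      nth_rewrite 2 [← h1' x]
      abel
    obtain ⟨y, hy, h2⟩ := (LinearPMap.mem_graph_iff G).1 h
    simp only at hy h2
    refine ⟨hy ▸ y.2, ?_⟩
    have e : (⟨(C * R) x, hy ▸ y.2⟩ : G.domain) = y := Subtype.ext hy.symm
    rw [e, h2]
    simp
  · have h := (hG _ _).1 (G.mem_graph x)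
    rw [map_sub] at h
    have e : R ((0 : ℂ) • (x : H) - G x) = x - R x := by
      rw [zero_smul, zero_sub, map_neg]
      rw [sub_eq_iff_eq_add] at h
      rw [h]
      abel
    rw [mul_apply_eq_comp, e, map_sub]
    exact h2' x

/-- A nonzero s in σ(R) corresponds to z = 1 - 1/s in σ(G), and s near 1 corresponds to z near 0. -/
theorem exists_spectral_gap {G : H →ₗ.[ℂ] H}
    (hG : ∀ u w, (u, w) ∈ G.graph ↔ R (u - w) = u) (hs : spectrum ℝ R ⊆ Set.Icc 0 1)
    (h : ∀ᶠ z in 𝓝[≠] (0 : ℂ), z ∈ operatorResolventSet G) :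
    ∃ δ : ℝ, 0 < δ ∧ ∀ s ∈ spectrum ℝ R, s = 1 ∨ s ≤ 1 - δ := by
  rw [eventually_nhdsWithin_iff, Metric.eventually_nhds_iff] at h
  obtain ⟨ε, hε, h⟩ := h
  -- The bound 1/2 ensures 1/s < 2, so that |1 - 1/s| = (1 - s)/s < ε.
  refine ⟨min (1 / 2) (ε / 2), by positivity, ?_⟩
  intro s hsp
  by_contra! hc
  obtain ⟨h1, h2⟩ := hc
  have h3 : 1 / 2 < s := by linarith [min_le_left (1 / 2) (ε / 2)]
  have h4 : 1 - s < ε / 2 := by linarith [min_le_right (1 / 2) (ε / 2)]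
  have h5 : s < 1 := lt_of_le_of_ne (hs hsp).2 h1
  have hspos : 0 < s := by linarith
  have h6 : 1 < s⁻¹ := (one_lt_inv₀ hspos).2 h5
  have hz : ((1 - s⁻¹ : ℝ) : ℂ) ∈ operatorResolventSet G := by
    refine h ?_ ?_
    · rw [dist_zero_right, Complex.norm_real, Real.norm_eq_abs, abs_of_neg (by linarith)]
      have : s⁻¹ - 1 = (1 - s) * s⁻¹ := by field_simp
      have h7 : s⁻¹ < 2 := by rw [inv_lt_comm₀ hspos two_pos]; linarith
      nlinarith
    · rw [Set.mem_compl_singleton_iff, Ne, Complex.ofReal_eq_zero]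
      linarith
  have hu := isUnit_one_sub_smul_of_mem_resolventSet hG hz
  rw [sub_sub_cancel] at hu
  refine hsp ?_
  have e : algebraMap ℝ (H →L[ℂ] H) s - R = algebraMap ℝ (H →L[ℂ] H) s * (1 - s⁻¹ • R) := by
    rw [Algebra.algebraMap_eq_smul_one, smul_mul_assoc, one_mul, smul_sub, smul_smul,
      mul_inv_cancel₀ hspos.ne', one_smul]
  change IsUnit _
  rw [e]
  exact ((IsUnit.mk0 s hspos.ne').map _).mul hu

/-- Real coefficients matter: the intended J is complex conjugation, which is only real-linear. -/
theorem aeval_comm_of_comm {J : H →L[ℝ] H} (hJ : ∀ x, J (R x) = R (J x)) (p : Polynomial ℝ)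
    (x : H) : J (Polynomial.aeval R p x) = Polynomial.aeval R p (J x) := by
  have h : ∀ (n : ℕ) (x : H), J ((R ^ n) x) = (R ^ n) (J x) := by
    intro n
    induction n with
    | zero => intro x; rfl
    | succ n ih =>
      intro x
      rw [pow_succ, mul_apply_eq_comp, mul_apply_eq_comp, ih, hJ]
  simp only [Polynomial.aeval_eq_sum_range, _root_.sum_apply, _root_.smul_apply, map_sum,
    map_smul, h]

end Resolvent

/-! ### Splitting off the spectral projection at 1 -/

section Decomposition

variable {H : Type*} [NormedAddCommGroup H] [InnerProductSpace ℂ H] [CompleteSpace H]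
  {R : H →L[ℂ] H}

theorem exists_bound_expSymbol_mul_inv_pow (k : ℕ) :
    ∃ M : ℝ, 0 ≤ M ∧ ∀ s ∈ Set.Icc (0 : ℝ) 1, expSymbol 1 s * s⁻¹ ^ k ≤ M := by
  obtain ⟨M, hM⟩ := isCompact_Icc.exists_bound_of_continuousOn
    (continuous_expSymbol_mul_inv_pow one_pos k).continuousOn (s := Set.Icc (0 : ℝ) 1)
  exact ⟨M, (norm_nonneg _).trans (hM 0 (by simp)), fun s hs => (le_abs_self _).trans (hM s hs)⟩

/-- One unit of time is kept to preserve flatness at s = 0, and the remaining t - 1 produces the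
decay, as 1/s - 1 ≥ δ. -/
theorem expSymbol_le_exp_mul {δ t s : ℝ} (ht : 1 < t) (h0 : 0 < s) (hδ : 0 < δ)
    (hsδ : s ≤ 1 - δ) : expSymbol t s ≤ Real.exp (-((t - 1) * δ)) * expSymbol 1 s := by
  have e : t = (t - 1) + 1 := by ring
  nth_rewrite 1 [e]
  rw [expSymbol_add (by linarith) one_pos h0.le]
  have h1 := (expSymbol_mem_Icc one_pos ⟨h0.le, by linarith⟩ : expSymbol 1 s ∈ _).1
  refine mul_le_mul_of_nonneg_right ?_ h1
  rw [expSymbol_of_pos (by linarith) h0]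
  have h2 : δ ≤ s⁻¹ - 1 := by
    have : s⁻¹ - 1 = (1 - s) * s⁻¹ := by field_simp
    have h7 : 1 ≤ s⁻¹ := (one_le_inv₀ h0).2 (by linarith)
    nlinarith
  gcongr

/-- If `1` is an isolated point of the spectrum of `R`, then the semigroup `exp (-t (R⁻¹ - 1))`
is the sum of the projection onto `ker (1 - R)` and an exponentially small part that factors
through any given power of `R` on both sides. -/
theorem exists_projection_add_decay (hR : IsSelfAdjoint R) (hs : spectrum ℝ R ⊆ Set.Icc 0 1)
    (h1 : (1 : ℝ) ∈ spectrum ℝ R) {δ : ℝ} (hδ : 0 < δ)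
    (hgap : ∀ s ∈ spectrum ℝ R, s = 1 ∨ s ≤ 1 - δ) :
    ∃ P : H →L[ℂ] H, IsSelfAdjoint P ∧ P ≠ 0 ∧ P * P = P ∧ R * P = P ∧
      ∀ n : ℕ, ∃ S : ℝ → H →L[ℂ] H,
        (∀ t, 0 < t → resolventSemigroup R t = P + R ^ n * S t * R ^ n) ∧
        Tendsto (fun t => ‖S t‖) atTop (𝓝 0) := by
  -- By the gap, this continuous ramp agrees on σ(R) with the indicator of {1}, so the continuous
  -- calculus yields the spectral projection.
  set q : ℝ → ℝ := fun s => max 0 (1 - (1 - s) / δ) with hq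
  have hqc : Continuous q := by fun_prop
  have hq1 : q 1 = 1 := by simp [hq]
  have hq0 : ∀ s, s ≤ 1 - δ → q s = 0 := by
    intro s h
    refine max_eq_left (sub_nonpos.2 ?_)
    rw [le_div_iff₀ hδ]
    linarith
  have hqs : ∀ s ∈ spectrum ℝ R, s * q s = q s := by
    intro s h
    rcases hgap s h with rfl | h
    · simp
    · simp [hq0 s h]
  have hqq : ∀ s ∈ spectrum ℝ R, q s * q s = q s := by
    intro s h
    rcases hgap s h with rfl | h
    · simp [hq1]
    · simp [hq0 s h]
  refine ⟨cfc q R, cfc_predicate q R, ?_, ?_, ?_, fun n => ?_⟩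
  · intro h
    have := norm_apply_le_norm_cfc q R h1 hqc.continuousOn
    rw [h, hq1] at this
    norm_num at this
  · rw [← cfc_mul q q R hqc.continuousOn hqc.continuousOn]
    exact cfc_congr hqq
  · nth_rewrite 1 [← cfc_id' ℝ R]
    rw [← cfc_mul (fun s => s) q R continuousOn_id hqc.continuousOn]
    exact cfc_congr hqs
  -- Chosen so that q + sⁿ k sⁿ equals the semigroup symbol on σ(R). At s = 0 every term vanishes.
  · set k : ℝ → ℝ → ℝ := fun t s => expSymbol t s * s⁻¹ ^ (2 * n) * (1 - q s) with hk
    refine ⟨fun t => cfc (k t) R, fun t ht => ?_, ?_⟩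
    · have hkc : Continuous (k t) :=
        (continuous_expSymbol_mul_inv_pow ht _).mul (continuous_const.sub hqc)
      rw [resolventSemigroup_of_pos R ht, ← cfc_pow_id (R := ℝ) R n,
        ← cfc_mul _ (k t) R (by fun_prop) hkc.continuousOn,
        ← cfc_mul _ _ R (by fun_prop) (by fun_prop),
        ← cfc_add R q _ hqc.continuousOn (by fun_prop)]
      refine cfc_congr fun s h => ?_
      rcases hgap s h with rfl | h'
      · simp [hk, hq1, expSymbol_of_pos ht one_pos]
      · rcases (hs h).1.eq_or_lt with rfl | h0
        · simp [hk, hq0 0 h', expSymbol_zero_right]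
        · simp only [hk, hq0 s h']
          rw [inv_pow]
          field_simp
          ring
    · obtain ⟨M, hM0, hM⟩ := exists_bound_expSymbol_mul_inv_pow (2 * n)
      have hlim : Tendsto (fun t : ℝ => Real.exp (-((t - 1) * δ)) * M) atTop (𝓝 0) := by
        rw [← zero_mul M]
        refine Tendsto.mul_const M (Real.tendsto_exp_neg_atTop_nhds_zero.comp ?_)
        exact (tendsto_atTop_add_const_right _ (-1 : ℝ) tendsto_id).atTop_mul_const hδ
      refine squeeze_zero' (Eventually.of_forall fun _ => norm_nonneg _) ?_ hlim
      filter_upwards [eventually_gt_atTop 1] with t ht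
      refine norm_cfc_le (by positivity) fun s h => ?_
      rcases hgap s h with rfl | h'
      · simp only [hk, hq1, sub_self, mul_zero, norm_zero]
        positivity
      · rcases (hs h).1.eq_or_lt with rfl | h0
        · simp only [hk, expSymbol_zero_right, zero_mul, norm_zero]
          positivity
        · have h2 := (expSymbol_mem_Icc (one_pos.trans ht) (hs h)).1
          simp only [hk, hq0 s h', sub_zero, mul_one]
          rw [Real.norm_eq_abs, abs_of_nonneg (by positivity)]
          calc _ ≤ (Real.exp (-((t - 1) * δ)) * expSymbol 1 s) * s⁻¹ ^ (2 * n) := by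
                gcongr
                exact expSymbol_le_exp_mul ht h0 hδ h'
            _ = Real.exp (-((t - 1) * δ)) * (expSymbol 1 s * s⁻¹ ^ (2 * n)) := by ring
            _ ≤ _ := by
                gcongr
                exact hM s (hs h)

/-- A real-linear operator that commutes with `R` commutes with real functions of `R`. -/
theorem cfc_comm_of_comm (hR : IsSelfAdjoint R) (hs : spectrum ℝ R ⊆ Set.Icc 0 1)
    {J : H →L[ℝ] H} (hJ : ∀ x, J (R x) = R (J x)) {f : ℝ → ℝ} (hf : Continuous f) (x : H) :
    J (cfc f R x) = cfc f R (J x) := by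
  rw [← sub_eq_zero, ← norm_le_zero_iff]
  refine le_of_forall_pos_le_add fun ε hε => ?_
  -- Weierstrass approximation, with an accuracy that makes the errors on both sides of the
  -- commutator sum to at most ε.
  obtain ⟨p, hp⟩ := exists_polynomial_near_of_continuousOn 0 1 f hf.continuousOn
    (ε / (‖J‖ * ‖x‖ + ‖J x‖ + 1)) (by positivity)
  set η := ε / (‖J‖ * ‖x‖ + ‖J x‖ + 1)
  have hη : 0 < η := by positivity
  have hB : ‖cfc f R - Polynomial.aeval R p‖ ≤ η := by
    rw [← cfc_polynomial p R, ← cfc_sub f _ R hf.continuousOn p.continuous.continuousOn]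
    refine norm_cfc_le hη.le fun s h => ?_
    rw [norm_sub_rev]
    exact (hp s (hs h)).le
  set B := cfc f R - Polynomial.aeval R p with hBdef
  have e : J (cfc f R x) - cfc f R (J x) = J (B x) - B (J x) := by
    simp only [hBdef, _root_.sub_apply, map_sub, aeval_comm_of_comm hJ]
    abel
  rw [e, zero_add]
  have h2 : ‖J (B x)‖ ≤ ‖J‖ * (η * ‖x‖) :=
    (J.le_opNorm _).trans (by gcongr; exact B.le_of_opNorm_le hB x)
  have h3 : ‖B (J x)‖ ≤ η * ‖J x‖ := B.le_of_opNorm_le hB _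
  have h4 : η * (‖J‖ * ‖x‖ + ‖J x‖ + 1) = ε := div_mul_cancel₀ _ (by positivity)
  linarith [norm_sub_le (J (B x)) (B (J x))]

end Decomposition

/-! ### Comparing μ with Lebesgue measure -/

section DensityMeasure

variable {N : ℕ} {m : EuclideanSpace ℝ (Fin N) → ℝ}
  {g : EuclideanSpace ℝ (Fin N) → EuclideanSpace ℝ (Fin N)}

theorem isProbabilityMeasure_densityMeasure (hm : IsProbabilityDensity m) :
    IsProbabilityMeasure (densityMeasure m) := by
  refine ⟨?_⟩
  rw [densityMeasure, withDensity_apply _ MeasurableSet.univ, Measure.restrict_univ,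
    ← ofReal_integral_eq_lintegral_ofReal hm.integrable hm.nonneg, hm.integral_eq_one,
    ENNReal.ofReal_one]

theorem HypothesisH1.ae_pos (h : HypothesisH1 m g) : ∀ᵐ x, 0 < m x := by
  have h1 : ∀ n : ℕ, ∀ᵐ x, x ∈ Metric.closedBall (0 : EuclideanSpace ℝ (Fin N)) n → 0 < m x := by
    intro n
    obtain ⟨c, hc, h2⟩ := h.lower_bound _ (isCompact_closedBall 0 (n : ℝ))
    rw [ae_restrict_iff' measurableSet_closedBall] at h2
    filter_upwards [h2] with x hx hx2 using hc.trans_le (hx hx2)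
  filter_upwards [ae_all_iff.2 h1] with x hx
  obtain ⟨n, hn⟩ := exists_nat_ge ‖x‖
  exact hx n (by simpa using hn)

theorem aemeasurable_ofReal_density (hm : IsProbabilityDensity m) :
    AEMeasurable (fun x => ENNReal.ofReal (m x)) :=
  hm.integrable.aestronglyMeasurable.aemeasurable.ennreal_ofReal

theorem volume_absolutelyContinuous_densityMeasure (hm : IsProbabilityDensity m)
    (h : HypothesisH1 m g) :
    (volume : Measure (EuclideanSpace ℝ (Fin N))) ≪ densityMeasure m := by
  refine withDensity_absolutelyContinuous' (aemeasurable_ofReal_density hm) ?_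
  filter_upwards [h.ae_pos] with x hx using (ENNReal.ofReal_pos.2 hx).ne'

theorem densityMeasure_absolutelyContinuous_volume :
    densityMeasure m ≪ (volume : Measure (EuclideanSpace ℝ (Fin N))) :=
  withDensity_absolutelyContinuous _ _

theorem integral_densityMeasure (hm : IsProbabilityDensity m) {F : Type*} [NormedAddCommGroup F]
    [NormedSpace ℝ F] (f : EuclideanSpace ℝ (Fin N) → F) :
    ∫ x, f x ∂densityMeasure m = ∫ x, m x • f x := by
  rw [densityMeasure, integral_withDensity_eq_integral_toReal_smul₀
    (aemeasurable_ofReal_density hm) (Eventually.of_forall fun _ => ENNReal.ofReal_lt_top)]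
  refine integral_congr_ae ?_
  filter_upwards [hm.nonneg] with x hx
  rw [ENNReal.toReal_ofReal hx]

theorem integrable_densityMeasure_iff (hm : IsProbabilityDensity m) {F : Type*}
    [NormedAddCommGroup F] [NormedSpace ℝ F] {f : EuclideanSpace ℝ (Fin N) → F} :
    Integrable f (densityMeasure m) ↔ Integrable fun x => m x • f x := by
  rw [densityMeasure, integrable_withDensity_iff_integrable_smul₀'
    (aemeasurable_ofReal_density hm) (Eventually.of_forall fun _ => ENNReal.ofReal_lt_top)]
  refine integrable_congr ?_
  filter_upwards [hm.nonneg] with x hx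
  rw [ENNReal.toReal_ofReal hx]

/-- The local lower bound on the density gives dx ≤ c⁻¹ dμ on K, hence L²_μ ⊂ L²_loc. -/
theorem exists_volume_restrict_le (h : HypothesisH1 m g)
    {K : Set (EuclideanSpace ℝ (Fin N))} (hK : IsCompact K) :
    ∃ C : ℝ≥0∞, C ≠ ⊤ ∧ volume.restrict K ≤ C • densityMeasure m := by
  obtain ⟨c, hc, h2⟩ := h.lower_bound K hK
  have hc' : ENNReal.ofReal c ≠ 0 := (ENNReal.ofReal_pos.2 hc).ne'
  refine ⟨(ENNReal.ofReal c)⁻¹, ENNReal.inv_ne_top.2 hc', Measure.le_iff.2 fun s hs => ?_⟩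
  rw [Measure.smul_apply, smul_eq_mul, mul_comm, ← div_eq_mul_inv,
    ENNReal.le_div_iff_mul_le (Or.inl hc') (Or.inl ENNReal.ofReal_ne_top), mul_comm,
    densityMeasure, withDensity_apply _ hs]
  calc ENNReal.ofReal c * (volume.restrict K) s
      = ∫⁻ _ in s, ENNReal.ofReal c ∂(volume.restrict K) := by
        rw [setLIntegral_const]
    _ ≤ ∫⁻ x in s, ENNReal.ofReal (m x) ∂(volume.restrict K) := by
        refine lintegral_mono_ae ?_
        filter_upwards [ae_restrict_of_ae h2] with x hx using ENNReal.ofReal_le_ofReal hx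
    _ ≤ ∫⁻ x in s, ENNReal.ofReal (m x) :=
        lintegral_mono' (Measure.restrict_mono_measure Measure.restrict_le_self _) le_rfl

theorem memLp_restrict_of_memLp_densityMeasure (h : HypothesisH1 m g) {F : Type*}
    [NormedAddCommGroup F] {f : EuclideanSpace ℝ (Fin N) → F} {p : ℝ≥0∞}
    (hf : MemLp f p (densityMeasure m)) {K : Set (EuclideanSpace ℝ (Fin N))} (hK : IsCompact K) :
    MemLp f p (volume.restrict K) := by
  obtain ⟨C, hC, hle⟩ := exists_volume_restrict_le h hK
  exact hf.of_measure_le_smul hC hle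

theorem MemLpLoc.locallyIntegrable {F : Type*} [NormedAddCommGroup F]
    {f : EuclideanSpace ℝ (Fin N) → F} (hf : MemLpLoc f 2) : LocallyIntegrable f := by
  rw [locallyIntegrable_iff]
  intro K hK
  have : IsFiniteMeasure (volume.restrict K) := ⟨by simpa using hK.measure_lt_top⟩
  exact (hf K hK).integrable one_le_two

theorem locallyIntegrable_of_memLp_densityMeasure (h : HypothesisH1 m g) {F : Type*}
    [NormedAddCommGroup F] {f : EuclideanSpace ℝ (Fin N) → F}
    (hf : MemLp f 2 (densityMeasure m)) : LocallyIntegrable f :=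
  MemLpLoc.locallyIntegrable fun _ hK => memLp_restrict_of_memLp_densityMeasure h hf hK

end DensityMeasure

/-! ### Integration by parts on test functions -/

section TestFunction

variable {N : ℕ} {m : EuclideanSpace ℝ (Fin N) → ℝ}
  {g : EuclideanSpace ℝ (Fin N) → EuclideanSpace ℝ (Fin N)}
  {φ ψ : EuclideanSpace ℝ (Fin N) → ℂ}

/-- The partial derivative of `φ` in the direction of the `i`-th coordinate. -/
noncomputable def partialDeriv {F : Type*} [NormedAddCommGroup F] [NormedSpace ℝ F] (i : Fin N)
    (φ : EuclideanSpace ℝ (Fin N) → F) (x : EuclideanSpace ℝ (Fin N)) : F :=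
  fderiv ℝ φ x (EuclideanSpace.single i 1)

theorem IsTestFunction.differentiable {F : Type*} [NormedAddCommGroup F] [NormedSpace ℝ F]
    {φ : EuclideanSpace ℝ (Fin N) → F} (h : IsTestFunction φ) : Differentiable ℝ φ :=
  h.1.differentiable (by simp)

theorem IsTestFunction.partialDeriv {F : Type*} [NormedAddCommGroup F] [NormedSpace ℝ F]
    {φ : EuclideanSpace ℝ (Fin N) → F} (h : IsTestFunction φ) (i : Fin N) :
    IsTestFunction (partialDeriv i φ) := by
  refine ⟨?_, h.2.fderiv_apply (𝕜 := ℝ) _⟩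
  exact (h.1.fderiv_right (m := ∞) (by simp)).clm_apply contDiff_const

theorem IsTestFunction.clm_comp {F F' : Type*} [NormedAddCommGroup F] [NormedSpace ℝ F]
    [NormedAddCommGroup F'] [NormedSpace ℝ F'] {φ : EuclideanSpace ℝ (Fin N) → F}
    (h : IsTestFunction φ) (T : F →L[ℝ] F') : IsTestFunction fun x => T (φ x) :=
  ⟨T.contDiff.comp h.1, h.2.comp_left (map_zero T)⟩

theorem IsTestFunction.mul (hφ : IsTestFunction φ) (hψ : IsTestFunction ψ) :
    IsTestFunction fun x => φ x * ψ x :=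
  ⟨hφ.1.mul hψ.1, hφ.2.mul_right⟩

theorem partialDeriv_clm_comp {F F' : Type*} [NormedAddCommGroup F] [NormedSpace ℝ F]
    [NormedAddCommGroup F'] [NormedSpace ℝ F'] {φ : EuclideanSpace ℝ (Fin N) → F}
    (h : IsTestFunction φ) (T : F →L[ℝ] F') (i : Fin N) :
    partialDeriv i (fun x => T (φ x)) = fun x => T (partialDeriv i φ x) := by
  funext x
  have := (T.hasFDerivAt.comp x (h.differentiable x).hasFDerivAt).fderiv
  simp only [Function.comp_def] at this
  rw [partialDeriv, this]
  rfl

theorem partialDeriv_mul (hφ : IsTestFunction φ) (hψ : IsTestFunction ψ) (i : Fin N)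
    (x : EuclideanSpace ℝ (Fin N)) :
    partialDeriv i (fun x => φ x * ψ x) x = partialDeriv i φ x * ψ x + φ x * partialDeriv i ψ x := by
  rw [partialDeriv, fderiv_fun_mul (hφ.differentiable x) (hψ.differentiable x)]
  simp only [partialDeriv, _root_.add_apply, _root_.smul_apply, smul_eq_mul]
  ring

theorem integrable_mul_test {f : EuclideanSpace ℝ (Fin N) → ℝ} (hf : LocallyIntegrable f)
    (hφ : IsTestFunction φ) : Integrable fun x => (f x : ℂ) * φ x := by
  have h : LocallyIntegrable fun x => (f x : ℂ) := fun x =>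
    let ⟨s, hs, hi⟩ := hf x
    ⟨s, hs, hi.ofReal⟩
  simpa [mul_comm] using h.integrable_smul_left_of_hasCompactSupport hφ.1.continuous hφ.2

theorem HypothesisH1.locallyIntegrable_grad (h : HypothesisH1 m g) (i : Fin N) :
    LocallyIntegrable fun x => g x i :=
  fun x =>
    let ⟨s, hs, hi⟩ := h.memLpLoc_grad.locallyIntegrable x
    ⟨s, hs, (EuclideanSpace.proj (𝕜 := ℝ) i).integrable_comp hi⟩

/-- The weak gradient is defined with real test functions, so the real and imaginary parts are
treated separately. -/
theorem HypothesisH1.integral_density_mul_partialDeriv (h : HypothesisH1 m g)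
    (hφ : IsTestFunction φ) (i : Fin N) :
    ∫ x, (m x : ℂ) * partialDeriv i φ x = -∫ x, (g x i : ℂ) * φ x := by
  have hm := h.memLpLoc.locallyIntegrable
  have hg := h.locallyIntegrable_grad i
  have I1 := integrable_mul_test hm (hφ.partialDeriv i)
  have I2 := integrable_mul_test hg hφ
  have key : ∀ T : ℂ →L[ℝ] ℝ, (∀ (r : ℝ) (z : ℂ), T (r * z) = r * T z) →
      T (∫ x, (m x : ℂ) * partialDeriv i φ x) = T (-∫ x, (g x i : ℂ) * φ x) := by
    intro T hT
    rw [map_neg, ← T.integral_comp_comm I1, ← T.integral_comp_comm I2]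
    have := h.isWeakGradient _ (hφ.clm_comp T) i
    have e := partialDeriv_clm_comp hφ T i
    simp only [hT]
    rw [← this]
    refine integral_congr_ae (Eventually.of_forall fun x => ?_)
    simp only
    rw [← congrFun e x]
    rfl
  refine Complex.ext (key Complex.reCLM fun r z => ?_) (key Complex.imCLM fun r z => ?_)
  · simp
  · simp

theorem laplacian_eq_sum_partialDeriv (hφ : IsTestFunction φ) (x : EuclideanSpace ℝ (Fin N)) :
    (Δ φ) x = ∑ i, partialDeriv i (partialDeriv i φ) x := by
  rw [InnerProductSpace.laplacian_eq_iteratedFDeriv_orthonormalBasis φ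
    (EuclideanSpace.basisFun (Fin N) ℝ)]
  refine Finset.sum_congr rfl fun i _ => ?_
  rw [iteratedFDeriv_two_apply]
  have hd : DifferentiableAt ℝ (fderiv ℝ φ) x :=
    (hφ.1.fderiv_right (m := ∞) (by simp)).differentiable (by simp) x
  simp only [EuclideanSpace.basisFun_apply, Matrix.cons_val_zero, Matrix.cons_val_one]
  unfold partialDeriv
  rw [fderiv_clm_apply hd (differentiableAt_const _)]
  simp

theorem kolmogorovExpr_eq_sum (hφ : IsTestFunction φ) (x : EuclideanSpace ℝ (Fin N)) :
    kolmogorovExpr m g φ x = ∑ i, (partialDeriv i (partialDeriv i φ) x +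
      (m x : ℂ)⁻¹ * (g x i * partialDeriv i φ x)) := by
  rw [kolmogorovExpr, laplacian_eq_sum_partialDeriv hφ, Finset.sum_add_distrib]
  congr 1
  have e : g x = ∑ i, g x i • (EuclideanSpace.single i (1 : ℝ)) := by
    have := (EuclideanSpace.basisFun (Fin N) ℝ).sum_repr (g x)
    simpa using this.symm
  rw [map_smul]
  nth_rewrite 1 [e]
  rw [map_sum, Finset.smul_sum]
  refine Finset.sum_congr rfl fun i _ => ?_
  rw [map_smul]
  simp [partialDeriv]

/-- Integration by parts for the Kolmogorov operator. -/
theorem integral_mul_kolmogorovExpr (hm : IsProbabilityDensity m) (h : HypothesisH1 m g)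
    (hφ : IsTestFunction φ) (hψ : IsTestFunction ψ) :
    ∫ x, ψ x * kolmogorovExpr m g φ x ∂densityMeasure m =
      -∑ i, ∫ x, partialDeriv i ψ x * partialDeriv i φ x ∂densityMeasure m := by
  have hml := h.memLpLoc.locallyIntegrable
  simp only [integral_densityMeasure hm]
  have e1 : ∫ x, m x • (ψ x * kolmogorovExpr m g φ x) =
      ∫ x, ∑ i, ((m x : ℂ) * (ψ x * partialDeriv i (partialDeriv i φ) x) +
        (g x i : ℂ) * (ψ x * partialDeriv i φ x)) := by
    refine integral_congr_ae ?_
    filter_upwards [h.ae_pos] with x hx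
    have hx' : (m x : ℂ) ≠ 0 := by exact_mod_cast hx.ne'
    rw [kolmogorovExpr_eq_sum hφ, Finset.mul_sum, Finset.smul_sum]
    refine Finset.sum_congr rfl fun i _ => ?_
    rw [Complex.real_smul]
    field_simp
  have I1 : ∀ i, Integrable fun x => (m x : ℂ) * (ψ x * partialDeriv i (partialDeriv i φ) x) :=
    fun i => integrable_mul_test hml (hψ.mul ((hφ.partialDeriv i).partialDeriv i))
  have I2 : ∀ i, Integrable fun x => (g x i : ℂ) * (ψ x * partialDeriv i φ x) :=
    fun i => integrable_mul_test (h.locallyIntegrable_grad i) (hψ.mul (hφ.partialDeriv i))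
  have I3 : ∀ i, Integrable fun x => (m x : ℂ) * (partialDeriv i ψ x * partialDeriv i φ x) :=
    fun i => integrable_mul_test hml ((hψ.partialDeriv i).mul (hφ.partialDeriv i))
  rw [e1, integral_finsetSum _ fun i _ => by exact (I1 i).add (I2 i), ← Finset.sum_neg_distrib]
  refine Finset.sum_congr rfl fun i _ => ?_
  rw [integral_add (I1 i) (I2 i)]
  -- The weak gradient is tested against ψ ∂ᵢφ. Its term with g matches the drift, because the
  -- density cancels m⁻¹.
  have h3 := HypothesisH1.integral_density_mul_partialDeriv h (hψ.mul (hφ.partialDeriv i)) i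
  simp only [partialDeriv_mul hψ (hφ.partialDeriv i), mul_add] at h3
  rw [integral_add (I3 i) (I1 i)] at h3
  simp only [Complex.real_smul]
  linear_combination h3

theorem integral_mul_kolmogorovExpr_comm (hm : IsProbabilityDensity m) (h : HypothesisH1 m g)
    (hφ : IsTestFunction φ) (hψ : IsTestFunction ψ) :
    ∫ x, ψ x * kolmogorovExpr m g φ x ∂densityMeasure m =
      ∫ x, φ x * kolmogorovExpr m g ψ x ∂densityMeasure m := by
  rw [integral_mul_kolmogorovExpr hm h hφ hψ, integral_mul_kolmogorovExpr hm h hψ hφ]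
  simp only [mul_comm]

theorem IsTestFunction.conj (hφ : IsTestFunction φ) : IsTestFunction fun x => star (φ x) :=
  hφ.clm_comp (Complex.conjCLE : ℂ →L[ℝ] ℂ)

theorem partialDeriv_conj (hφ : IsTestFunction φ) (i : Fin N) :
    partialDeriv i (fun x => star (φ x)) = fun x => star (partialDeriv i φ x) :=
  partialDeriv_clm_comp hφ (Complex.conjCLE : ℂ →L[ℝ] ℂ) i

theorem kolmogorovExpr_conj (hφ : IsTestFunction φ) (x : EuclideanSpace ℝ (Fin N)) :
    kolmogorovExpr m g (fun x => star (φ x)) x = star (kolmogorovExpr m g φ x) := by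
  rw [kolmogorovExpr_eq_sum hφ, kolmogorovExpr_eq_sum hφ.conj, star_sum]
  refine Finset.sum_congr rfl fun i _ => ?_
  rw [partialDeriv_conj hφ, partialDeriv_conj (hφ.partialDeriv i)]
  simp

theorem IsTestFunction.memLp (hm : IsProbabilityDensity m) (hφ : IsTestFunction φ) (p : ℝ≥0∞) :
    MemLp φ p (densityMeasure m) := by
  have := isProbabilityMeasure_densityMeasure hm
  exact hφ.1.continuous.memLp_of_hasCompactSupport hφ.2

/-- The squared norm against μ is |aφ|²/m dx, and 1/m is bounded on the support of φ. It serves the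
drift term (a = gᵢ) and the representation of test functionals (a = 1). -/
theorem memLp_inv_density_mul (hm : IsProbabilityDensity m) (h : HypothesisH1 m g)
    {a : EuclideanSpace ℝ (Fin N) → ℝ} (ha : MemLpLoc a 2) (hφ : IsTestFunction φ) :
    MemLp (fun x => (m x : ℂ)⁻¹ * (a x * φ x)) 2 (densityMeasure m) := by
  have hae : AEStronglyMeasurable (fun x => (m x : ℂ)⁻¹ * (a x * φ x)) volume := by
    have h1 := ha.locallyIntegrable.aestronglyMeasurable.aemeasurable
    have h2 := hm.integrable.aestronglyMeasurable.aemeasurable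
    have h3 := hφ.1.continuous.measurable.aemeasurable (μ := volume)
    have : AEMeasurable (fun x => (m x : ℂ)⁻¹ * (a x * φ x)) volume :=
      (h2.complex_ofReal.inv).mul (h1.complex_ofReal.mul h3)
    exact this.aestronglyMeasurable
  rw [memLp_two_iff_integrable_sq_norm
    (hae.mono_ac densityMeasure_absolutelyContinuous_volume), integrable_densityMeasure_iff hm]
  obtain ⟨c, hc, hcm⟩ := h.lower_bound _ hφ.2
  obtain ⟨B, hB⟩ := hφ.1.continuous.bounded_above_of_compact_support hφ.2
  have hK := (ha _ hφ.2).integrable_norm_pow two_ne_zero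
  have hI : Integrable ((tsupport φ).indicator fun x => B ^ 2 * c⁻¹ * ‖a x‖ ^ 2) :=
    (integrable_indicator_iff (isClosed_tsupport φ).measurableSet).2 (hK.const_mul _)
  refine hI.mono' ?_ ?_
  · exact hm.integrable.aestronglyMeasurable.smul (hae.norm.pow 2)
  · rw [ae_restrict_iff' (isClosed_tsupport φ).measurableSet] at hcm
    filter_upwards [hcm] with x hx
    by_cases hxs : x ∈ tsupport φ
    · have hcx := hx hxs
      have hmpos : 0 < m x := hc.trans_le hcx
      rw [Set.indicator_of_mem hxs]
      have e : ‖m x • ‖(m x : ℂ)⁻¹ * (a x * φ x)‖ ^ 2‖ = ‖φ x‖ ^ 2 * (m x)⁻¹ * ‖a x‖ ^ 2 := by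
        rw [smul_eq_mul, norm_mul, norm_pow, norm_norm, norm_mul, norm_mul, norm_inv,
          Complex.norm_real, Complex.norm_real, Real.norm_of_nonneg hmpos.le]
        field_simp
      rw [e]
      have h1 : (m x)⁻¹ ≤ c⁻¹ := inv_anti₀ hc hcx
      have h3 := hB x
      gcongr
    · rw [Set.indicator_of_notMem hxs, image_eq_zero_of_notMem_tsupport hxs]
      simp

theorem HypothesisH1.memLpLoc_grad_apply (h : HypothesisH1 m g) (i : Fin N) :
    MemLpLoc (fun x => g x i) 2 :=
  fun K hK => (EuclideanSpace.proj (𝕜 := ℝ) i).comp_memLp' (h.memLpLoc_grad K hK)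

theorem memLp_kolmogorovExpr (hm : IsProbabilityDensity m) (h : HypothesisH1 m g)
    (hφ : IsTestFunction φ) : MemLp (kolmogorovExpr m g φ) 2 (densityMeasure m) := by
  have e : kolmogorovExpr m g φ = fun x => ∑ i, (partialDeriv i (partialDeriv i φ) x +
      (m x : ℂ)⁻¹ * (g x i * partialDeriv i φ x)) := funext (kolmogorovExpr_eq_sum hφ)
  rw [e]
  refine memLp_finsetSum _ fun i _ => ?_
  exact (((hφ.partialDeriv i).partialDeriv i).memLp hm 2).add
    (memLp_inv_density_mul hm h (h.memLpLoc_grad_apply i) (hφ.partialDeriv i))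

end TestFunction

/-! ### Vanishing weak gradient implies constancy -/

section ConstantFunctions

variable {N : ℕ}

/-- A locally integrable function with vanishing weak gradient is constant. -/
theorem exists_ae_eq_const_of_weakGradient_eq_zero {u : EuclideanSpace ℝ (Fin N) → ℂ}
    (hu : LocallyIntegrable u)
    (h : ∀ ψ : EuclideanSpace ℝ (Fin N) → ℝ, IsTestFunction ψ → ∀ i,
      ∫ x, partialDeriv i ψ x • u x = 0) : ∃ c : ℂ, ∀ᵐ x, u x = c := by
  -- Mollifiers with shrinking support. The fixed radius ratio 2 is what a.e. convergence for
  -- locally integrable u requires.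
  let φ : ℕ → ContDiffBump (0 : EuclideanSpace ℝ (Fin N)) := fun n =>
    ⟨1 / ((n : ℝ) + 1), 2 * (1 / ((n : ℝ) + 1)), by positivity,
      by have : 0 < 1 / ((n : ℝ) + 1) := by positivity
         linarith⟩
  have hlim : Tendsto (fun n => (φ n).rOut) atTop (𝓝 0) := by
    have := (tendsto_one_div_add_atTop_nhds_zero_nat (𝕜 := ℝ)).const_mul 2
    rw [mul_zero] at this
    exact this
  have hae := ContDiffBump.ae_convolution_tendsto_right_of_locallyIntegrable (μ := volume)
    (K := 2) hlim (Eventually.of_forall fun n => le_rfl) hu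
  have hconst : ∀ n x y,
      (convolution ((φ n).normed volume) u (ContinuousLinearMap.lsmul ℝ ℝ) volume) x =
      (convolution ((φ n).normed volume) u (ContinuousLinearMap.lsmul ℝ ℝ) volume) y := by
    intro n
    have hcs := (φ n).hasCompactSupport_normed (μ := volume)
    have hcd : ContDiff ℝ ∞ ((φ n).normed volume) := (φ n).contDiff_normed
    have hd := fun x => hcs.hasFDerivAt_convolution_left (ContinuousLinearMap.lsmul ℝ ℝ)
      (hcd.of_le (by simp)) hu x
    refine is_const_of_fderiv_eq_zero (𝕜 := ℝ) (fun x => (hd x).differentiableAt) fun x => ?_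
    rw [(hd x).fderiv]
    have hex : ConvolutionExistsAt (fderiv ℝ ((φ n).normed volume)) u x
        ((ContinuousLinearMap.lsmul ℝ ℝ).precompL (EuclideanSpace ℝ (Fin N))) volume :=
      (hcs.fderiv ℝ).convolutionExists_left _ (hcd.continuous_fderiv (by simp)) hu x
    refine ContinuousLinearMap.coe_injective
      ((EuclideanSpace.basisFun (Fin N) ℝ).toBasis.ext fun i => ?_)
    -- The derivative of the mollification at x pairs u, up to sign, with a derivative of this
    -- reflected bump, so it vanishes.
    have hψ : IsTestFunction fun t => (φ n).normed volume (x - t) := by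
      refine ⟨hcd.comp (contDiff_const.sub contDiff_id), ?_⟩
      exact hcs.comp_homeomorph (Homeomorph.subLeft x)
    have h0 := h _ hψ i
    have hp : ∀ t, partialDeriv i (fun t => (φ n).normed volume (x - t)) t =
        -fderiv ℝ ((φ n).normed volume) (x - t) (EuclideanSpace.single i 1) := by
      intro t
      have hd' := ((hcd.differentiable (by simp) (x - t)).hasFDerivAt.comp t
        ((hasFDerivAt_id t).const_sub x)).fderiv
      simp only [Function.comp_def] at hd'
      rw [partialDeriv, hd']
      simp
    rw [convolution_eq_swap]
    have hint := hex.integrable_swap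
    simp only [OrthonormalBasis.coe_toBasis, EuclideanSpace.basisFun_apply,
      ContinuousLinearMap.coe_coe, ContinuousLinearMap.toLinearMap_zero,
      LinearMap.zero_apply]
    rw [ContinuousLinearMap.integral_apply hint]
    simp only [hp, neg_smul, integral_neg, neg_eq_zero] at h0
    exact h0
  obtain ⟨x₀, hx₀⟩ := hae.exists
  refine ⟨u x₀, ?_⟩
  filter_upwards [hae] with x hx
  refine tendsto_nhds_unique hx (hx₀.congr fun n => hconst n x₀ x)

end ConstantFunctions

/-! ### Closability, reality and kernel of L -/

section KolmogorovOperator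

variable {N : ℕ} {m : EuclideanSpace ℝ (Fin N) → ℝ}
  {g : EuclideanSpace ℝ (Fin N) → EuclideanSpace ℝ (Fin N)}

theorem kolmogorovCoreGraph_snd_eq_zero (hm : IsProbabilityDensity m) (h : HypothesisH1 m g) :
    ∀ p ∈ kolmogorovCoreGraph m g, p.1 = 0 → p.2 = 0 := by
  rintro ⟨u, w⟩ ⟨φ, hφ, h1, h2⟩ h0
  simp only at h1 h2 h0 ⊢
  subst h0
  have e : φ =ᵐ[volume] 0 :=
    volume_absolutelyContinuous_densityMeasure hm h (h1.symm.trans (Lp.coeFn_zero _ _ _))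
  have e2 : φ = 0 := (hφ.1.continuous.ae_eq_iff_eq volume continuous_const).1 e
  subst e2
  have e3 : (0 : EuclideanSpace ℝ (Fin N) → ℂ) = fun _ => 0 := rfl
  rw [Lp.eq_zero_iff_ae_eq_zero]
  exact h2.trans (Eventually.of_forall fun x => by simp [kolmogorovExpr, e3])

theorem graph_toLinearPMap_kolmogorovCoreGraph (hm : IsProbabilityDensity m)
    (h : HypothesisH1 m g) :
    (kolmogorovCoreGraph m g).toLinearPMap.graph = kolmogorovCoreGraph m g :=
  Submodule.toLinearPMap_graph_eq _ (kolmogorovCoreGraph_snd_eq_zero hm h)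

theorem dense_domain_kolmogorovCore (hm : IsProbabilityDensity m) (h : HypothesisH1 m g) :
    Dense ((kolmogorovCoreGraph m g).toLinearPMap.domain : Set (L2mu m)) := by
  have := isProbabilityMeasure_densityMeasure hm
  refine (Lp.dense_hasCompactSupport_contDiff (F := ℂ) (μ := densityMeasure m) (p := 2)
    (by simp)).mono ?_
  rintro f ⟨φ, h1, h2, h3⟩
  have hφ : IsTestFunction φ := ⟨h3, h2⟩
  refine LinearPMap.mem_domain_iff.2 ⟨(memLp_kolmogorovExpr hm h hφ).toLp, ?_⟩
  rw [graph_toLinearPMap_kolmogorovCoreGraph hm h]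
  exact ⟨φ, hφ, h1, (memLp_kolmogorovExpr hm h hφ).coeFn_toLp⟩

theorem inner_kolmogorovCoreGraph (hm : IsProbabilityDensity m) (h : HypothesisH1 m g)
    {p q : L2mu m × L2mu m} (hp : p ∈ kolmogorovCoreGraph m g) (hq : q ∈ kolmogorovCoreGraph m g) :
    inner ℂ p.2 q.1 = inner ℂ p.1 q.2 := by
  obtain ⟨φ, hφ, h1, h2⟩ := hp
  obtain ⟨ψ, hψ, h3, h4⟩ := hq
  rw [L2.inner_def, L2.inner_def]
  have e1 : ∫ x, inner ℂ (p.2 x) (q.1 x) ∂densityMeasure m =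
      ∫ x, ψ x * kolmogorovExpr m g (fun x => star (φ x)) x ∂densityMeasure m := by
    refine integral_congr_ae ?_
    filter_upwards [h2, h3] with x hx hx'
    rw [hx, hx', kolmogorovExpr_conj hφ]
    rfl
  have e2 : ∫ x, inner ℂ (p.1 x) (q.2 x) ∂densityMeasure m =
      ∫ x, star (φ x) * kolmogorovExpr m g ψ x ∂densityMeasure m := by
    refine integral_congr_ae ?_
    filter_upwards [h1, h4] with x hx hx'
    rw [hx, hx', mul_comm]
    rfl
  rw [e1, e2, integral_mul_kolmogorovExpr_comm hm h hφ.conj hψ]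

/-- A densely defined symmetric operator is contained in its adjoint, which is closed. -/
theorem isClosable_kolmogorovCore (hm : IsProbabilityDensity m) (h : HypothesisH1 m g) :
    (kolmogorovCoreGraph m g).toLinearPMap.IsClosable := by
  have hd := dense_domain_kolmogorovCore hm h
  have hf : (kolmogorovCoreGraph m g).toLinearPMap.IsFormalAdjoint
      (kolmogorovCoreGraph m g).toLinearPMap := by
    intro x y
    have hg := graph_toLinearPMap_kolmogorovCoreGraph hm h
    exact inner_kolmogorovCoreGraph hm h (hg ▸ LinearPMap.mem_graph _ x)
      (hg ▸ LinearPMap.mem_graph _ y)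
  exact (LinearPMap.adjoint_isClosed hd).isClosable.leIsClosable (hf.le_adjoint hd)

theorem isClosed_kolmogorovOperator (hm : IsProbabilityDensity m) (h : HypothesisH1 m g) :
    (kolmogorovOperator m g).IsClosed :=
  (isClosable_kolmogorovCore hm h).closure_isClosed

theorem dense_domain_kolmogorovOperator (hm : IsProbabilityDensity m) (h : HypothesisH1 m g) :
    Dense ((kolmogorovOperator m g).domain : Set (L2mu m)) :=
  (dense_domain_kolmogorovCore hm h).mono (LinearPMap.le_closure _).1

theorem mem_graph_kolmogorovOperator (hm : IsProbabilityDensity m) (h : HypothesisH1 m g)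
    {p : L2mu m × L2mu m} :
    p ∈ (kolmogorovOperator m g).graph ↔
      p ∈ closure (kolmogorovCoreGraph m g : Set (L2mu m × L2mu m)) := by
  have := (isClosable_kolmogorovCore hm h).graph_closure_eq_closure_graph
  rw [graph_toLinearPMap_kolmogorovCoreGraph hm h] at this
  rw [kolmogorovOperator, ← this]
  rfl

/-- Complex conjugation on `L²_μ`. -/
noncomputable def conjL2 (m : EuclideanSpace ℝ (Fin N) → ℝ) : L2mu m →L[ℝ] L2mu m :=
  ContinuousLinearMap.compLpL 2 (densityMeasure m) (Complex.conjCLE : ℂ →L[ℝ] ℂ)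

theorem coeFn_conjL2 (f : L2mu m) : conjL2 m f =ᵐ[densityMeasure m] fun x => star (f x) :=
  ContinuousLinearMap.coeFn_compLpL _ f

theorem conjL2_conjL2 (f : L2mu m) : conjL2 m (conjL2 m f) = f := by
  refine Lp.ext ?_
  filter_upwards [coeFn_conjL2 (conjL2 m f), coeFn_conjL2 f] with x h1 h2
  rw [h1, h2, star_star]

theorem inner_conjL2 (f k : L2mu m) : inner ℂ (conjL2 m f) (conjL2 m k) = star (inner ℂ f k) := by
  rw [L2.inner_def, L2.inner_def, RCLike.star_def, ← integral_conj]
  refine integral_congr_ae ?_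
  filter_upwards [coeFn_conjL2 f, coeFn_conjL2 k] with x h1 h2
  rw [h1, h2]
  simp

theorem conjL2_mem_graph (hm : IsProbabilityDensity m) (h : HypothesisH1 m g)
    {p : L2mu m × L2mu m} (hp : p ∈ (kolmogorovOperator m g).graph) :
    (conjL2 m p.1, conjL2 m p.2) ∈ (kolmogorovOperator m g).graph := by
  rw [mem_graph_kolmogorovOperator hm h] at hp ⊢
  have hc : Continuous fun p : L2mu m × L2mu m => (conjL2 m p.1, conjL2 m p.2) := by fun_prop
  refine map_mem_closure (t := kolmogorovCoreGraph m g) hc hp ?_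
  rintro q ⟨φ, hφ, h1, h2⟩
  refine ⟨fun x => star (φ x), hφ.conj, ?_, ?_⟩
  · filter_upwards [coeFn_conjL2 q.1, h1] with x hx hx'
    rw [hx, hx']
  · filter_upwards [coeFn_conjL2 q.2, h2] with x hx hx'
    rw [hx, hx', kolmogorovExpr_conj hφ]

/-- Integration against a test function is a bounded functional on `L²_μ`. -/
theorem exists_inner_eq_integral_test (hm : IsProbabilityDensity m) (h : HypothesisH1 m g)
    {ψ : EuclideanSpace ℝ (Fin N) → ℂ} (hψ : IsTestFunction ψ) :
    ∃ W : L2mu m, ∀ v : EuclideanSpace ℝ (Fin N) → ℂ, ∀ V : L2mu m,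
      V =ᵐ[densityMeasure m] v → inner ℂ W V = ∫ x, ψ x * v x := by
  have h1 : MemLpLoc (fun _ : EuclideanSpace ℝ (Fin N) => (1 : ℝ)) 2 := by
    intro K hK
    have : IsFiniteMeasure (volume.restrict K) := ⟨by simpa using hK.measure_lt_top⟩
    exact memLp_const 1
  -- The representative is the conjugate of ψ divided by m: the weight in μ cancels the inverse.
  have hW := memLp_inv_density_mul hm h h1 hψ.conj
  refine ⟨hW.toLp, fun v V hV => ?_⟩
  rw [L2.inner_def]
  calc _ = ∫ x, (m x : ℂ)⁻¹ * (ψ x * v x) ∂densityMeasure m := by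
        refine integral_congr_ae ?_
        filter_upwards [hW.coeFn_toLp, hV] with x hx hx'
        rw [hx, hx']
        simp
        ring
    _ = _ := by
        rw [integral_densityMeasure hm]
        refine integral_congr_ae ?_
        filter_upwards [h.ae_pos] with x hx
        have hx' : (m x : ℂ) ≠ 0 := by exact_mod_cast hx.ne'
        rw [Complex.real_smul, mul_inv_cancel_left₀ hx']

/-- Integration by parts gives ⟨u, Lu⟩ = -∑ⱼ ‖∂ⱼφ‖², and Cauchy–Schwarz finishes. Gradients are thus
controlled in the graph norm. -/
theorem norm_partialDeriv_toLp_sq_le (hm : IsProbabilityDensity m) (h : HypothesisH1 m g)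
    {φ : EuclideanSpace ℝ (Fin N) → ℂ} (hφ : IsTestFunction φ) {u w : L2mu m}
    (h1 : u =ᵐ[densityMeasure m] φ) (h2 : w =ᵐ[densityMeasure m] kolmogorovExpr m g φ)
    (i : Fin N) : ‖((hφ.partialDeriv i).memLp hm 2).toLp‖ ^ 2 ≤ ‖u‖ * ‖w‖ := by
  have hD : ∀ j, ∫ x, partialDeriv j (fun x => star (φ x)) x * partialDeriv j φ x
      ∂densityMeasure m = ((‖((hφ.partialDeriv j).memLp hm 2).toLp‖ ^ 2 : ℝ) : ℂ) := by
    intro j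
    have := inner_self_eq_norm_sq_to_K (𝕜 := ℂ) ((hφ.partialDeriv j).memLp hm 2).toLp
    rw [Complex.ofReal_pow]
    refine Eq.trans ?_ this
    rw [L2.inner_def]
    refine integral_congr_ae ?_
    filter_upwards [((hφ.partialDeriv j).memLp hm 2).coeFn_toLp] with x hx
    rw [hx, partialDeriv_conj hφ, mul_comm]
    rfl
  have h3 : inner ℂ u w = -((∑ j, ‖((hφ.partialDeriv j).memLp hm 2).toLp‖ ^ 2 : ℝ) : ℂ) := by
    rw [Complex.ofReal_sum, ← Finset.sum_congr rfl fun j _ => hD j,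
      ← integral_mul_kolmogorovExpr hm h hφ hφ.conj, L2.inner_def]
    refine integral_congr_ae ?_
    filter_upwards [h1, h2] with x hx hx'
    rw [hx, hx', mul_comm]
    rfl
  have h4 := norm_inner_le_norm (𝕜 := ℂ) u w
  rw [h3, norm_neg, Complex.norm_real, Real.norm_eq_abs] at h4
  refine le_trans ?_ ((le_abs_self _).trans h4)
  exact Finset.single_le_sum (f := fun j => ‖((hφ.partialDeriv j).memLp hm 2).toLp‖ ^ 2)
    (fun j _ => sq_nonneg _) (Finset.mem_univ i)

theorem integral_partialDeriv_mul (i : Fin N) {φ ψ : EuclideanSpace ℝ (Fin N) → ℂ}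
    (hφ : IsTestFunction φ) (hψ : IsTestFunction ψ) :
    ∫ x, partialDeriv i ψ x * φ x = -∫ x, ψ x * partialDeriv i φ x := by
  have hI : ∀ {a b : EuclideanSpace ℝ (Fin N) → ℂ}, IsTestFunction a → IsTestFunction b →
      Integrable fun x => a x * b x := fun ha hb =>
    (ha.mul hb).1.continuous.integrable_of_hasCompactSupport (ha.mul hb).2
  have := integral_mul_fderiv_eq_neg_fderiv_mul_of_integrable (μ := volume)
    (v := EuclideanSpace.single i (1 : ℝ)) (f := ψ) (g := φ)
    (hI (hψ.partialDeriv i) hφ) (hI hψ (hφ.partialDeriv i)) (hI hψ hφ)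
    (fun x _ => hψ.differentiable x) (fun x _ => hφ.differentiable x)
  unfold partialDeriv
  rw [this, neg_neg]

/-- The kernel of the Kolmogorov operator consists of constant functions. -/
theorem exists_ae_eq_const_of_kolmogorovOperator_eq_zero (hm : IsProbabilityDensity m)
    (h : HypothesisH1 m g) {u : L2mu m} (hu : (u, 0) ∈ (kolmogorovOperator m g).graph) :
    ∃ c : ℂ, u =ᵐ[densityMeasure m] fun _ => c := by
  have hloc := locallyIntegrable_of_memLp_densityMeasure h (Lp.memLp u)
  suffices ∃ c : ℂ, ∀ᵐ x, u x = c by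
    obtain ⟨c, hc⟩ := this
    exact ⟨c, densityMeasure_absolutelyContinuous_volume hc⟩
  refine exists_ae_eq_const_of_weakGradient_eq_zero hloc fun ψ₀ hψ₀ i => ?_
  have hψ := hψ₀.clm_comp Complex.ofRealCLM
  set ψ : EuclideanSpace ℝ (Fin N) → ℂ := fun x => Complex.ofRealCLM (ψ₀ x) with hψdef
  have e0 : ∀ x, partialDeriv i ψ₀ x • u x = partialDeriv i ψ x * u x := by
    intro x
    rw [hψdef, partialDeriv_clm_comp hψ₀ Complex.ofRealCLM]
    simp
  simp only [e0]
  rw [mem_graph_kolmogorovOperator hm h, mem_closure_iff_seq_limit] at hu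
  obtain ⟨p, hp, hlim⟩ := hu
  obtain ⟨W, hW⟩ := exists_inner_eq_integral_test hm h (hψ.partialDeriv i)
  obtain ⟨W', hW'⟩ := exists_inner_eq_integral_test hm h hψ
  rw [← hW u u EventuallyEq.rfl]
  have l1 : Tendsto (fun n => inner ℂ W (p n).1) atTop (𝓝 (inner ℂ W u)) :=
    tendsto_const_nhds.inner ((continuous_fst.tendsto _).comp hlim)
  -- For core functions φₙ → u with Lφₙ → 0, the derivative moves from ψ to φₙ, whose gradient is at
  -- most √(‖φₙ‖ ‖Lφₙ‖) in norm and so tends to 0.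
  refine tendsto_nhds_unique l1 (squeeze_zero_norm (a := fun n =>
    ‖W'‖ * √(‖(p n).1‖ * ‖(p n).2‖)) (fun n => ?_) ?_)
  · obtain ⟨φ, hφ, h1, h2⟩ := hp n
    have hD := norm_partialDeriv_toLp_sq_le hm h hφ h1 h2 i
    rw [hW φ _ h1, integral_partialDeriv_mul i hφ hψ, norm_neg,
      ← hW' _ _ ((hφ.partialDeriv i).memLp hm 2).coeFn_toLp]
    refine (norm_inner_le_norm _ _).trans ?_
    gcongr
    exact Real.le_sqrt_of_sq_le hD
  · have l2 := ((continuous_fst.tendsto _).comp hlim).norm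
    have l3 := ((continuous_snd.tendsto _).comp hlim).norm
    have := ((Real.continuous_sqrt.tendsto _).comp (l2.mul l3)).const_mul ‖W'‖
    simpa using this

end KolmogorovOperator

/-! ### Kernel projection, smoothing and local lower bounds for A -/

section BiKolmogorov

variable {N : ℕ} {m : EuclideanSpace ℝ (Fin N) → ℝ}
  {g : EuclideanSpace ℝ (Fin N) → EuclideanSpace ℝ (Fin N)} {R : L2mu m →L[ℂ] L2mu m}

theorem LinearPMap.mem_neg_graph_iff {H : Type*} [NormedAddCommGroup H] [NormedSpace ℂ H]
    (A : H →ₗ.[ℂ] H) (u w : H) : (u, w) ∈ (-A).graph ↔ (u, -w) ∈ A.graph := by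
  simp only [LinearPMap.mem_graph_iff]
  constructor
  · rintro ⟨y, h1, h2⟩
    exact ⟨y, h1, by rw [← h2, LinearPMap.neg_apply, neg_neg]⟩
  · rintro ⟨y, h1, h2⟩
    exact ⟨y, h1, by rw [LinearPMap.neg_apply, h2, neg_neg]⟩

/-- L has real coefficients, so conjugation preserves D(L) and conjugates the form. Uniqueness of
the weak solution then transfers this to R. -/
theorem conjL2_comm_resolvent (hm : IsProbabilityDensity m) (h : HypothesisH1 m g)
    (hA : ∀ u w, (u, w) ∈ (biKolmogorovOperator m g).graph ↔ R (u + w) = u) (x : L2mu m) :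
    conjL2 m (R x) = R (conjL2 m x) := by
  have hgr : (biKolmogorovOperator m g).graph = squareFormGraph (kolmogorovOperator m g) :=
    squareFormOperator_graph _ (dense_domain_kolmogorovOperator hm h)
  rw [hgr] at hA
  have hL : ∀ v : (kolmogorovOperator m g).domain, ∃ hv : conjL2 m v ∈
      (kolmogorovOperator m g).domain, kolmogorovOperator m g ⟨conjL2 m v, hv⟩ =
        conjL2 m (kolmogorovOperator m g v) := by
    intro v
    obtain ⟨y, h1, h2⟩ := (LinearPMap.mem_graph_iff _).1
      (conjL2_mem_graph hm h (LinearPMap.mem_graph _ v))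
    simp only at h1 h2
    refine ⟨h1 ▸ y.2, ?_⟩
    rw [← h2]
    congr 1
    exact Subtype.ext h1.symm
  obtain ⟨hu, hu2⟩ := (hA (R x) (x - R x)).2 (by simp)
  obtain ⟨hJu, hJu2⟩ := hL ⟨R x, hu⟩
  have key : (conjL2 m (R x), conjL2 m (x - R x)) ∈ squareFormGraph (kolmogorovOperator m g) := by
    refine ⟨hJu, fun v => ?_⟩
    obtain ⟨hJv, hJv2⟩ := hL v
    have h3 := hu2 ⟨_, hJv⟩
    rw [squareForm, hJv2] at h3
    rw [squareForm, hJu2, ← conjL2_conjL2 (kolmogorovOperator m g v), inner_conjL2, h3,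
      ← inner_conjL2, conjL2_conjL2]
  have := (hA _ _).1 key
  rw [← map_add, add_sub_cancel] at this
  exact this.symm

/-- A fixed point of R satisfies Au = 0, and testing the form with u itself gives ‖Lu‖² = 0. -/
theorem exists_ae_eq_const_of_resolvent_eq (hm : IsProbabilityDensity m) (h : HypothesisH1 m g)
    (hA : ∀ u w, (u, w) ∈ (biKolmogorovOperator m g).graph ↔ R (u + w) = u) {u : L2mu m}
    (hu : R u = u) : ∃ c : ℂ, u =ᵐ[densityMeasure m] fun _ => c := by
  have hgr : (biKolmogorovOperator m g).graph = squareFormGraph (kolmogorovOperator m g) :=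
    squareFormOperator_graph _ (dense_domain_kolmogorovOperator hm h)
  rw [hgr] at hA
  obtain ⟨hd, h1⟩ := (hA u 0).2 (by simpa using hu)
  have h2 := h1 ⟨u, hd⟩
  rw [squareForm, inner_zero_right, inner_self_eq_zero] at h2
  refine exists_ae_eq_const_of_kolmogorovOperator_eq_zero hm h ?_
  exact (LinearPMap.mem_graph_iff _).2 ⟨⟨u, hd⟩, rfl, h2⟩

/-- P is a nonzero orthogonal projection with range inside the constants, hence onto them. The
constant 1 is a unit vector, so Pf = ⟨1, f⟩ 1. -/
theorem projection_apply_eq (hm : IsProbabilityDensity m) {P : L2mu m →L[ℂ] L2mu m}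
    (hP : IsSelfAdjoint P) (hP0 : P ≠ 0) (hPP : P * P = P)
    (hconst : ∀ u, P u = u → ∃ c : ℂ, u =ᵐ[densityMeasure m] fun _ => c) (f : L2mu m) :
    P f =ᵐ[densityMeasure m] fun _ => ∫ x, f x ∂densityMeasure m := by
  have := isProbabilityMeasure_densityMeasure hm
  set e : L2mu m := (memLp_const (1 : ℂ)).toLp with he
  have hee : e =ᵐ[densityMeasure m] fun _ => 1 := MemLp.coeFn_toLp _
  have hc : ∀ x, ∃ c : ℂ, P x = c • e := by
    intro x
    obtain ⟨c, hc⟩ := hconst (P x) (congrArg (fun B : L2mu m →L[ℂ] L2mu m => B x) hPP)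
    refine ⟨c, Lp.ext ?_⟩
    filter_upwards [hc, Lp.coeFn_smul c e, hee] with y h1 h2 h3
    rw [h1, h2, Pi.smul_apply, h3, smul_eq_mul, mul_one]
  have hPe : P e = e := by
    obtain ⟨x, hx⟩ : ∃ x, P x ≠ 0 := by
      by_contra! hx
      exact hP0 (ContinuousLinearMap.ext hx)
    obtain ⟨c, hcx⟩ := hc x
    have hc0 : c ≠ 0 := by
      rintro rfl
      exact hx (by rw [hcx, zero_smul])
    have h1 : P (P x) = P x := congrArg (fun B : L2mu m →L[ℂ] L2mu m => B x) hPP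
    rw [hcx, map_smul] at h1
    exact smul_right_injective _ hc0 h1
  have hint : ∀ f : L2mu m, inner ℂ e f = ∫ x, f x ∂densityMeasure m := by
    intro f
    rw [L2.inner_def]
    refine integral_congr_ae ?_
    filter_upwards [hee] with x hx
    rw [hx]
    simp
  obtain ⟨c, hcf⟩ := hc f
  have hcc : c = ∫ x, f x ∂densityMeasure m := by
    rw [← hint, ← hPe, ← ContinuousLinearMap.adjoint_inner_right,
      ContinuousLinearMap.isSelfAdjoint_iff'.1 hP, hcf, inner_smul_right, hint,
      integral_congr_ae hee]
    simp
  rw [hcf, hcc]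
  filter_upwards [Lp.coeFn_smul (∫ x, f x ∂densityMeasure m) e, hee] with y h2 h3
  rw [h2, Pi.smul_apply, h3, smul_eq_mul, mul_one]

theorem integrable_coeFn (hm : IsProbabilityDensity m) (f : L2mu m) :
    Integrable f (densityMeasure m) := by
  have := isProbabilityMeasure_densityMeasure hm
  exact (Lp.memLp f).integrable one_le_two

theorem norm_inner_le_of_bound (hm : IsProbabilityDensity m) {K : Set (EuclideanSpace ℝ (Fin N))}
    {k v : L2mu m} {C : ℝ} (hk : ∀ᵐ x ∂densityMeasure m, x ∉ K → k x = 0)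
    (hv : ∀ᵐ x ∂densityMeasure m, x ∈ K → ‖v x‖ ≤ C) :
    ‖inner ℂ k v‖ ≤ C * ∫ x, ‖k x‖ ∂densityMeasure m := by
  rw [L2.inner_def, ← integral_const_mul]
  refine norm_integral_le_of_norm_le ((integrable_coeFn hm k).norm.const_mul C) ?_
  filter_upwards [hk, hv] with x h1 h2
  by_cases hx : x ∈ K
  · refine (norm_inner_le_norm _ _).trans ?_
    rw [mul_comm]
    gcongr
    exact h2 hx
  · rw [h1 hx]
    simp

theorem MemLpLoc.exists_bound {u : EuclideanSpace ℝ (Fin N) → ℂ} (hu : MemLpLoc u ⊤)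
    {K : Set (EuclideanSpace ℝ (Fin N))} (hK : IsCompact K) :
    ∃ C : ℝ, ∀ᵐ x ∂densityMeasure m, x ∈ K → ‖u x‖ ≤ C := by
  have h := hu K hK
  refine ⟨(eLpNorm u ⊤ (volume.restrict K)).toReal,
    densityMeasure_absolutelyContinuous_volume ?_⟩
  have h2 : ∀ᵐ x ∂volume.restrict K, ‖u x‖ ≤ (eLpNorm u ⊤ (volume.restrict K)).toReal := by
    have h3 : ∀ᵐ x ∂volume.restrict K, ‖u x‖ₑ ≤ eLpNorm u ⊤ (volume.restrict K) := by
      rw [eLpNorm_exponent_top]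
      exact ae_le_eLpNormEssSup
    filter_upwards [h3] with x hx
    have := ENNReal.toReal_mono h.2.ne hx
    simpa using this
  exact (ae_restrict_iff' hK.measurableSet).1 h2

/-- If `B` is self-adjoint with values in `L^∞_loc`, then `B` is bounded from `L¹(K)` to `L²`
for every compact set `K`. -/
theorem exists_norm_le_integral_norm (hm : IsProbabilityDensity m) {B : L2mu m →L[ℂ] L2mu m}
    (hB : IsSelfAdjoint B) (hloc : ∀ x, MemLpLoc (B x) ⊤)
    {K : Set (EuclideanSpace ℝ (Fin N))} (hK : IsCompact K) :
    ∃ C : ℝ, ∀ k : L2mu m, (∀ᵐ x ∂densityMeasure m, x ∉ K → k x = 0) →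
      ‖B k‖ ≤ C * ∫ x, ‖k x‖ ∂densityMeasure m := by
  -- Uniform boundedness is applied to the functionals ⟨Bk, ·⟩, for k in the L¹ unit ball supported
  -- in K. For fixed x they are bounded since ⟨Bk, x⟩ = ⟨k, Bx⟩ and Bx is bounded on K.
  let ι := {k : L2mu m // (∀ᵐ x ∂densityMeasure m, x ∉ K → k x = 0) ∧
    ∫ x, ‖k x‖ ∂densityMeasure m ≤ 1}
  have hpt : ∀ x, ∃ C, ∀ i : ι, ‖innerSL ℂ (B i.1) x‖ ≤ C := by
    intro x
    obtain ⟨C, hC⟩ := (hloc x).exists_bound (m := m) hK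
    refine ⟨|C|, fun i => ?_⟩
    rw [innerSL_apply_apply, ← ContinuousLinearMap.adjoint_inner_right,
      ContinuousLinearMap.isSelfAdjoint_iff'.1 hB]
    refine (norm_inner_le_of_bound hm (C := |C|) i.2.1 ?_).trans
      (mul_le_of_le_one_right (abs_nonneg C) i.2.2)
    filter_upwards [hC] with y hy hyK using (hy hyK).trans (le_abs_self C)
  obtain ⟨C, hC⟩ := banach_steinhaus hpt
  refine ⟨C, fun k hk => ?_⟩
  set a := ∫ x, ‖k x‖ ∂densityMeasure m with ha
  have ha0 : 0 ≤ a := integral_nonneg fun _ => norm_nonneg _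
  rcases ha0.eq_or_lt with h0 | h0
  · have h1 := (integral_eq_zero_iff_of_nonneg (fun _ => norm_nonneg _)
      (integrable_coeFn hm k).norm).1 h0.symm
    have h2 : k = 0 := by
      rw [Lp.eq_zero_iff_ae_eq_zero]
      filter_upwards [h1] with x hx using norm_eq_zero.1 hx
    rw [h2, ← h0]
    simp
  · have hsm := Lp.coeFn_smul ((a : ℂ)⁻¹) k
    have hmem : (∀ᵐ x ∂densityMeasure m, x ∉ K → ((a : ℂ)⁻¹ • k) x = 0) ∧
        ∫ x, ‖((a : ℂ)⁻¹ • k) x‖ ∂densityMeasure m ≤ 1 := by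
      constructor
      · filter_upwards [hsm, hk] with x h1 h2 hx
        rw [h1, Pi.smul_apply, h2 hx, smul_zero]
      · have : ∫ x, ‖((a : ℂ)⁻¹ • k) x‖ ∂densityMeasure m =
            ∫ x, a⁻¹ * ‖k x‖ ∂densityMeasure m := by
          refine integral_congr_ae ?_
          filter_upwards [hsm] with x h1
          rw [h1, Pi.smul_apply, norm_smul, norm_inv, Complex.norm_real, Real.norm_of_nonneg ha0]
        rw [this, integral_const_mul, ← ha, inv_mul_cancel₀ h0.ne']
    have h3 := hC ⟨_, hmem⟩
    rw [innerSL_apply_norm, map_smul, norm_smul, norm_inv, Complex.norm_real,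
      Real.norm_of_nonneg ha0, inv_mul_le_iff₀ h0] at h3
    linarith

theorem cutoff_coeFn {K : Set (EuclideanSpace ℝ (Fin N))} (hK : IsCompact K) (f : L2mu m) :
    cutoff hK f =ᵐ[densityMeasure m] K.indicator f :=
  MemLp.coeFn_toLp _

theorem IsPositiveOn.cutoff_nonneg {K : Set (EuclideanSpace ℝ (Fin N))} (hK : IsCompact K)
    {f : L2mu m} (hf : IsPositiveOn K f) : ∀ᵐ x ∂densityMeasure m, 0 ≤ cutoff hK f x := by
  have h1 := (ae_restrict_iff' hK.measurableSet).1 hf.1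
  filter_upwards [cutoff_coeFn hK f, densityMeasure_absolutelyContinuous_volume h1] with x hx hx1
  rw [hx]
  by_cases hxK : x ∈ K
  · rw [Set.indicator_of_mem hxK]
    exact hx1 hxK
  · rw [Set.indicator_of_notMem hxK]

theorem IsPositiveOn.integral_norm_cutoff_pos (hm : IsProbabilityDensity m)
    (h : HypothesisH1 m g) {K : Set (EuclideanSpace ℝ (Fin N))} (hK : IsCompact K)
    {f : L2mu m} (hf : IsPositiveOn K f) : 0 < ∫ x, ‖cutoff hK f x‖ ∂densityMeasure m := by
  refine lt_of_le_of_ne (integral_nonneg fun _ => norm_nonneg _) fun h0 => ?_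
  have h1 := (integral_eq_zero_iff_of_nonneg (fun _ => norm_nonneg _)
    (integrable_coeFn hm _).norm).1 h0.symm
  have h2 : ∀ᵐ x ∂densityMeasure m, K.indicator f x = 0 := by
    filter_upwards [h1, cutoff_coeFn hK f] with x hx hx2
    rw [← hx2]
    exact norm_eq_zero.1 hx
  have h3 := volume_absolutelyContinuous_densityMeasure hm h h2
  refine hf.2.ne' (measure_mono_null (fun x hx => ?_) h3)
  change ¬ K.indicator f x = 0
  rw [Set.indicator_of_mem hx.1]
  exact hx.2.ne'

theorem IsPositiveOn.integral_cutoff {K : Set (EuclideanSpace ℝ (Fin N))} (hK : IsCompact K)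
    {f : L2mu m} (hf : IsPositiveOn K f) :
    ∫ x, cutoff hK f x ∂densityMeasure m =
      ((∫ x, ‖cutoff hK f x‖ ∂densityMeasure m : ℝ) : ℂ) := by
  rw [← integral_complex_ofReal]
  refine integral_congr_ae ?_
  filter_upwards [hf.cutoff_nonneg hK] with x hx using (Complex.norm_of_nonneg' hx).symm

theorem IsPositiveOn.conjL2_cutoff {K : Set (EuclideanSpace ℝ (Fin N))} (hK : IsCompact K)
    {f : L2mu m} (hf : IsPositiveOn K f) : conjL2 m (cutoff hK f) = cutoff hK f := by
  refine Lp.ext ?_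
  filter_upwards [coeFn_conjL2 (cutoff hK f), hf.cutoff_nonneg hK] with x h1 h2
  rw [h1]
  exact Complex.conj_eq_iff_im.2 (Complex.nonneg_iff.1 h2).2.symm

/-- A lower bound for a real element of `L²_μ` on `K` follows from lower bounds for its integrals
over the measurable subsets of `K`. -/
theorem ae_le_of_forall_inner_indicator (hm : IsProbabilityDensity m) (h : HypothesisH1 m g)
    {K : Set (EuclideanSpace ℝ (Fin N))} (hK : IsCompact K) {v : L2mu m}
    (hv : conjL2 m v = v) {c : ℝ}
    (hc : ∀ s : Set (EuclideanSpace ℝ (Fin N)), MeasurableSet s → s ⊆ K →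
      c * (densityMeasure m).real s ≤ (∫ x in s, v x ∂densityMeasure m).re) :
    ∀ᵐ x ∂volume.restrict K, (c : ℂ) ≤ v x := by
  have := isProbabilityMeasure_densityMeasure hm
  have hI := integrable_coeFn hm v
  have h1 : (fun _ => c) ≤ᵐ[(densityMeasure m).restrict K] fun x => (v x).re := by
    refine ae_le_of_forall_setIntegral_le (integrable_const c) hI.re.restrict fun s hs _ => ?_
    rw [Measure.restrict_restrict hs]
    have h2 := hc (s ∩ K) (hs.inter hK.measurableSet) Set.inter_subset_right
    have h3 : (∫ x in s ∩ K, v x ∂densityMeasure m).re =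
        ∫ x in s ∩ K, (v x).re ∂densityMeasure m := (integral_re hI.restrict).symm
    rw [setIntegral_const, smul_eq_mul, mul_comm, ← h3]
    exact h2
  have h4 : ∀ᵐ x ∂(densityMeasure m).restrict K, (v x).im = 0 := by
    refine ae_restrict_of_ae ?_
    have := coeFn_conjL2 v
    rw [hv] at this
    filter_upwards [this] with x hx using Complex.conj_eq_iff_im.1 hx.symm
  have hac := (volume_absolutelyContinuous_densityMeasure hm h).restrict K
  filter_upwards [hac h1, hac h4] with x hx1 hx2
  rw [Complex.le_def]
  exact ⟨by simpa using hx1, by simpa using hx2.symm⟩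

/-- The lower bound for the semigroup on `K`, with a threshold that depends on `K` only. -/
theorem isLocallyUniformlyEventuallyPositive_of_decay (hm : IsProbabilityDensity m)
    (h : HypothesisH1 m g) {T S : ℝ → L2mu m →L[ℂ] L2mu m} {P B : L2mu m →L[ℂ] L2mu m}
    (hB : IsSelfAdjoint B) (hloc : ∀ x, MemLpLoc (B x) ⊤)
    (hP : ∀ f, P f =ᵐ[densityMeasure m] fun _ => ∫ x, f x ∂densityMeasure m)
    (hT : ∀ t, 0 < t → T t = P + B * S t * B) (hS : Tendsto (fun t => ‖S t‖) atTop (𝓝 0))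
    (hconj : ∀ t, 0 < t → ∀ x, conjL2 m (T t x) = T t (conjL2 m x)) :
    IsLocallyUniformlyEventuallyPositive T := by
  have := isProbabilityMeasure_densityMeasure hm
  intro K hK
  obtain ⟨C, hC⟩ := exists_norm_le_integral_norm hm hB hloc hK
  -- The constant C depends only on K, so the threshold is fixed before f is introduced.
  have hev : ∀ᶠ t in atTop, C ^ 2 * ‖S t‖ < 1 / 2 := by
    have h0 := hS.const_mul (C ^ 2)
    rw [mul_zero] at h0
    exact h0.eventually_lt_const (by norm_num)
  obtain ⟨t₁, ht₁⟩ := eventually_atTop.1 hev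
  refine ⟨max t₁ 1, by positivity, fun f hf => ?_⟩
  set a := ∫ x, ‖cutoff hK f x‖ ∂densityMeasure m with ha
  have ha0 : 0 < a := hf.integral_norm_cutoff_pos hm h hK
  refine ⟨a / 2, by positivity, fun t ht => ?_⟩
  have ht0 : 0 < t := one_pos.trans_le ((le_max_right _ _).trans ht)
  refine ae_le_of_forall_inner_indicator hm h hK ?_ fun s hs hsK => ?_
  · rw [hconj t ht0, hf.conjL2_cutoff hK]
  set e : L2mu m := indicatorConstLp 2 hs (measure_ne_top _ _) (1 : ℂ) with he
  have hee : e =ᵐ[densityMeasure m] s.indicator fun _ => 1 := indicatorConstLp_coeFn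
  have hint : ∀ v : L2mu m, inner ℂ e v = ∫ x in s, v x ∂densityMeasure m := fun v =>
    L2.inner_indicatorConstLp_one hs (measure_ne_top _ _) v
  have h1 : ‖B e‖ ≤ C * (densityMeasure m).real s := by
    have h2 := hC e (by
      filter_upwards [hee] with x hx hxK
      rw [hx, Set.indicator_of_notMem fun hxs => hxK (hsK hxs)])
    have h3 : ∫ x, ‖e x‖ ∂densityMeasure m = (densityMeasure m).real s := by
      rw [← integral_indicator_one hs]
      refine integral_congr_ae ?_
      filter_upwards [hee] with x hx
      rw [hx, norm_indicator_eq_indicator_norm]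
      simp [Set.indicator]
    rwa [h3] at h2
  have h2 : ‖B (cutoff hK f)‖ ≤ C * a := hC _ (by
    filter_upwards [cutoff_coeFn hK f] with x hx hxK
    rw [hx, Set.indicator_of_notMem hxK])
  -- Moving the outer B onto the indicator lets the L¹ bound act on both sides, so the error carries
  -- the same factor a μ(s) as the main term.
  have h3 : ‖inner ℂ e (B (S t (B (cutoff hK f))))‖ ≤
      1 / 2 * (a * (densityMeasure m).real s) := by
    rw [← ContinuousLinearMap.adjoint_inner_left, ContinuousLinearMap.isSelfAdjoint_iff'.1 hB]
    calc _ ≤ ‖B e‖ * ‖S t (B (cutoff hK f))‖ := norm_inner_le_norm _ _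
      _ ≤ (C * (densityMeasure m).real s) * (‖S t‖ * (C * a)) := by
          have := (S t).le_opNorm_of_le h2
          have h0 : 0 ≤ C * (densityMeasure m).real s := (norm_nonneg _).trans h1
          gcongr
      _ = (C ^ 2 * ‖S t‖) * (a * (densityMeasure m).real s) := by ring
      _ ≤ _ := by
          gcongr
          exact (ht₁ t ((le_max_left _ _).trans ht)).le
  have h4 : inner ℂ e (P (cutoff hK f)) = ((a * (densityMeasure m).real s : ℝ) : ℂ) := by
    rw [hint, integral_congr_ae (ae_restrict_of_ae (hP _)), hf.integral_cutoff hK,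
      setIntegral_const, ← ha]
    simp [mul_comm]
  rw [← hint, hT t ht0, _root_.add_apply, mul_apply_eq_comp, mul_apply_eq_comp, inner_add_right,
    Complex.add_re, h4, Complex.ofReal_re]
  have h5 := (abs_le.1 ((Complex.abs_re_le_norm _).trans h3)).1
  linarith

end BiKolmogorov

/-! ### Assembling the theorem -/

theorem mainTheorem11 (N : ℕ) (hN : 1 ≤ N)
    (m : EuclideanSpace ℝ (Fin N) → ℝ)
    (g : EuclideanSpace ℝ (Fin N) → EuclideanSpace ℝ (Fin N))
    (hm : IsProbabilityDensity m) (hH1 : HypothesisH1 m g)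
    (hdom : ∃ n : ℕ, ∀ u : L2mu m, MemPowDomain (biKolmogorovOperator m g) n u → MemLpLoc u ⊤)
    (hpole : IsSimplePoleOfSpectrum (-biKolmogorovOperator m g) 0) :
    ∃ T : ℝ → L2mu m →L[ℂ] L2mu m,
      IsC0SemigroupGeneratedBy T (-biKolmogorovOperator m g) ∧
        IsLocallyUniformlyEventuallyPositive T := by
  obtain ⟨R, hR, hs, hA⟩ := exists_resolvent_squareFormOperator
    (isClosed_kolmogorovOperator hm hH1) (dense_domain_kolmogorovOperator hm hH1)
  have hG : ∀ u w, (u, w) ∈ (-biKolmogorovOperator m g).graph ↔ R (u - w) = u := by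
    intro u w
    rw [LinearPMap.mem_neg_graph_iff, sub_eq_add_neg]
    exact hA u (-w)
  refine ⟨resolventSemigroup R, isC0SemigroupGeneratedBy_resolventSemigroup hR hs hG, ?_⟩
  obtain ⟨δ, hδ, hgap⟩ := exists_spectral_gap hG hs hpole.2.1
  obtain ⟨P, hPsa, hP0, hPP, hRP, hdec⟩ := exists_projection_add_decay hR hs
    (one_mem_spectrum_of_zero_mem hG hpole.1) hδ hgap
  obtain ⟨n, hn⟩ := hdom
  obtain ⟨S, hS, hS0⟩ := hdec n
  have hP := projection_apply_eq hm hPsa hP0 hPP fun u hu =>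
    exists_ae_eq_const_of_resolvent_eq hm hH1 hA (by
      rw [← hu]
      exact congrArg (fun B : L2mu m →L[ℂ] L2mu m => B u) hRP)
  refine isLocallyUniformlyEventuallyPositive_of_decay hm hH1 (hR.pow n)
    (fun x => hn _ (memPowDomain_pow_apply hA n x)) hP hS hS0 fun t ht x => ?_
  rw [resolventSemigroup_of_pos R ht]
  exact cfc_comm_of_comm hR hs (conjL2_comm_resolvent hm hH1 hA) (continuous_expSymbol t) x
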